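/- **Setting.** Let $G$ be a countable group with a left Følner sequence $(F_n)_{n}$ of finite subsets ($|gF_n\triangle F_n|/|F_n|\to 0$ for every $g\in G$), so $G$ is amenable; let $d\in\mathbb N$ and $[d]=\{1,\dots,d\}$. A $G^d$-space $\mathbf X=(X,\mu,T_1,\dots,T_d)$ is a standard Borel probability space $(X,\mu)$ with $d$ commuting actions $T_1,\dots,T_d$ of $G$ by measurable $\mu$-preserving transformations. Write $\Sigma_X$ for its Borel $\sigma$-algebra, and for $a\le b$ put $T_{[a;b]}^g=T_a^g\cdots T_b^g$ and $T_{(a;b]}^g=T_{[a+1;b]}^g$. An extension $\xi:\mathbf Y\to\mathbf X$ of $G^d$-spaces is a measurable map that carries the measure of $\mathbf Y$ to that of $\mathbf X$ and intertwines the actions almost everywhere. *Relative independence.* If $\Phi\subseteq\Sigma_1\cap\Sigma_2$ are $\sigma$-subalgebras of a probability space $(\Omega,\theta)$, then $\Sigma_1,\Sigma_2$ are relatively independent over $\Phi$ under $\theta$ if $\int fg\,d\theta=\int \mathsf E_\theta(f|\Phi)\,\mathsf E_\theta(g|\Phi)\,d\theta$ for all bounded $f,g$ that are respectively $\Sigma_1$-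 and $\Sigma_2$-measurable. Finitely many $\sigma$-subalgebras $\Sigma_i$ are relatively independent over further $\sigma$-subalgebras $\Phi_i\subseteq\Sigma_i$ if $\int\prod_i f_i\,d\theta=\int\prod_i\mathsf E_\theta(f_i|\Phi_i)\,d\theta$ for all bounded $\Sigma_i$-measurable $f_i$. *The $\sigma$-algebras $\Phi^e$.* Let $\binom{[d]}{\ge2}$ be the family of subsets of $[d]$ with at least two elements. For $e=\{i_1<\dots<i_\ell\}$ in it let $$\Phi^e_{\mathbf X}=\{A\in\Sigma_X:\ \mu(T^g_{(i_s;i_{s+1}]}A\,\triangle\,A)=0\ \text{ for all } g\in G,\ 1\le s<\ell\},$$ and for $\mathcal I\subseteq\binom{[d]}{\ge 2}$ let $\Phi^{\mathcal I}_{\mathbf X}=\bigvee_{e\in\mathcal I}\Phi^e_{\mathbf X}$ (the trivial $\sigma$-algebra if $\mathcal I=\emptyset$). An up-set in $\binom{[d]}{\ge2}$ is a subfamily closed under passing to supersets in $[d]$; in particular let $\langle i\rangle=\{e\in\binom{[d]}{\ge2}: i\in e\}$. *Full satedness.* $\mathbf X$ is fully sated if, for every $\mathcal I\subseteq\binom{[d]}{\ge2}$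 and every extension $\xi:\mathbf Y\to\mathbf X$, the $\sigma$-algebras $\xi^{-1}(\Sigma_X)$ and $\Phi^{\mathcal I}_{\mathbf Y}$ are relatively independent over $\xi^{-1}(\Phi^{\mathcal I}_{\mathbf X})$ under the measure of $\mathbf Y$. *Limit coupling.* The limit coupling $\lambda$ of $\mathbf X$ is the probability measure on $X^d$, all of whose marginals are $\mu$, that is the limit of $$\lambda_n=\frac1{|F_n|}\sum_{g\in F_n}\int_X\delta_{(T_{[1;1]}^gx,\,T_{[1;2]}^gx,\,\dots,\,T_{[1;d]}^gx)}\,\mu(dx)$$ in the sense that $\lambda_n(A_1\times\dots\times A_d)\to\lambda(A_1\times\dots\times A_d)$ for all measurable $A_1,\dots,A_d\subseteq X$. **Theorem.** Let $\mathbf X$ be a fully sated $G^d$-space with limit coupling $\lambda$, and let $\pi_i:X^d\to X$, $i\in[d]$, be the coordinate projections. 1. The $\sigma$-algebras $\pi_i^{-1}(\Sigma_X)$, $i=1,\dots,d$, are relatively independent under $\lambda$ over the further $\sigma$-subalgebras $\pi_i^{-1}(\Phi^{\langle i\rangle}_{\mathbf X})$, $i=1,\dots,d$. 2. The family $(\Phi^e_{\mathbf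 X})_e$, indexed by $e\in\binom{[d]}{\ge2}$, has the following properties: - (i) if $a\subseteq e$ then $\Phi^a_{\mathbf X}\supseteq\Phi^e_{\mathbf X}$; - (ii) if $i,j\in e$ and $A\in\Phi^e_{\mathbf X}$ then $\lambda(\pi_i^{-1}(A)\triangle\pi_j^{-1}(A))=0$; hence the lifts $\pi_i^{-1}(\Phi^e_{\mathbf X})$, $i\in e$, have a common $\lambda$-completion (within the Borel sets of $X^d$), denoted $\hat\Phi^e_{\mathbf X}$; - (iii) for all up-sets $\mathcal I,\mathcal J\subseteq\binom{[d]}{\ge2}$, with $\hat\Phi^{\mathcal I}_{\mathbf X}:=\bigvee_{e\in\mathcal I}\hat\Phi^e_{\mathbf X}$, the $\sigma$-algebras $\hat\Phi^{\mathcal I}_{\mathbf X}$ and $\hat\Phi^{\mathcal J}_{\mathbf X}$ are relatively independent under $\lambda$ over $\hat\Phi^{\mathcal I\cap\mathcal J}_{\mathbf X}$. -/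

import Mathlib

open MeasureTheory Filter

universe u v

noncomputable section

/-- A `Γ`-space `(X, μ, T)`: a standard Borel probability space with an action of `Γ` by
measurable `μ`-preserving transformations. -/
structure GSpace (Γ : Type v) [Group Γ] where
  carrier : Type u
  [measurableSpace : MeasurableSpace carrier]
  [standardBorel : StandardBorelSpace carrier]
  μ : Measure carrier
  [isProbabilityMeasure : IsProbabilityMeasure μ]
  T : Γ → carrier → carrier
  T_one : ∀ x, T 1 x = x
  T_mul : ∀ g h x, T (g * h) x = T g (T h x)
  measurePreserving : ∀ g, MeasurePreserving (T g) μ μ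

attribute [instance] GSpace.measurableSpace GSpace.standardBorel GSpace.isProbabilityMeasure

/-- `ξ : Y → X` is a factor map of `Γ`-spaces (equivalently, makes `Y` a `Γ`-extension of `X`);
equivariance is required almost everywhere. -/
structure IsFactorMap {Γ : Type v} [Group Γ] (Y X : GSpace.{u} Γ)
    (ξ : Y.carrier → X.carrier) : Prop where
  measurePreserving : MeasurePreserving ξ Y.μ X.μ
  equivariant : ∀ g, ∀ᵐ y ∂Y.μ, X.T g (ξ y) = ξ (Y.T g y)

/-- The `σ`-subalgebras `m₁` and `m₂` are relatively independent over `m` under `μ`, where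
`m ⊆ m₁ ∩ m₂`. -/
structure RelIndep {Ω : Type*} {mΩ : MeasurableSpace Ω} (μ : Measure Ω)
    (m₁ m₂ m : MeasurableSpace Ω) : Prop where
  le_left : m ≤ m₁
  le_right : m ≤ m₂
  left_le : m₁ ≤ mΩ
  right_le : m₂ ≤ mΩ
  integral_mul : ∀ f g : Ω → ℝ, Measurable[m₁] f → Measurable[m₂] g →
    (∃ C, ∀ ω, |f ω| ≤ C) → (∃ C, ∀ ω, |g ω| ≤ C) →
    ∫ ω, f ω * g ω ∂μ = ∫ ω, (μ[f | m]) ω * (μ[g | m]) ω ∂μ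

/-- A finite family of `σ`-subalgebras `m i` is relatively independent under `μ` over the further
`σ`-subalgebras `n i ⊆ m i`. -/
structure RelIndepFamily {Ω ι : Type*} [Fintype ι] {mΩ : MeasurableSpace Ω} (μ : Measure Ω)
    (m n : ι → MeasurableSpace Ω) : Prop where
  le : ∀ i, n i ≤ m i
  le_ambient : ∀ i, m i ≤ mΩ
  integral_prod : ∀ f : ι → Ω → ℝ, (∀ i, Measurable[m i] (f i)) →
    (∀ i, ∃ C, ∀ ω, |f i ω| ≤ C) →
    ∫ ω, ∏ i, f i ω ∂μ = ∫ ω, ∏ i, (μ[f i | n i]) ω ∂μ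

/-- `X` is sated for `F`, an assignment of a `σ`-subalgebra to each `Γ`-space: for every extension
`ξ : Y → X`, the `σ`-subalgebras `ξ⁻¹(Σ_X)` and `F Y` are relatively independent over `ξ⁻¹(F X)`.
Every standard Borel space is isomorphic to one in `Type u`, so the universe of `Y` is no
restriction. -/
def IsSated {Γ : Type v} [Group Γ]
    (F : (Y : GSpace.{u} Γ) → MeasurableSpace Y.carrier) (X : GSpace.{u} Γ) : Prop :=
  ∀ (Y : GSpace.{u} Γ) (ξ : Y.carrier → X.carrier), IsFactorMap Y X ξ →
    RelIndep Y.μ (X.measurableSpace.comap ξ) (F Y) ((F X).comap ξ)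

/-- The `σ`-algebra of Borel sets that are almost invariant under `T h` for each `h ∈ S`. -/
@[reducible] def almostInvariant {Γ : Type v} [Group Γ] (X : GSpace.{u} Γ) (S : Set Γ) :
    MeasurableSpace X.carrier where
  MeasurableSet' A := MeasurableSet A ∧ ∀ h ∈ S, X.T h ⁻¹' A =ᵐ[X.μ] A
  measurableSet_empty := ⟨MeasurableSet.empty, fun _ _ => by simp⟩
  measurableSet_compl A hA := ⟨hA.1.compl, fun h hh => (hA.2 h hh).compl⟩
  measurableSet_iUnion A hA := ⟨MeasurableSet.iUnion fun n => (hA n).1, fun h hh => by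
    rw [Set.preimage_iUnion]
    exact Filter.EventuallyEq.countable_iUnion fun n => (hA n).2 h hh⟩

section Tuples

variable {G : Type v} [Group G] {d : ℕ}

/-- A `G^d`-space is a `GSpace (Fin d → G)`, the `i`-th of the `d` commuting actions being that of
the `i`-th copy of `G`. The element `initialTuple i g` acts as `T_{[1;i]}^g`. -/
def initialTuple (i : Fin d) (g : G) : Fin d → G := fun k => if k ≤ i then g else 1

/-- The element of `G^d` that acts as `T_{(a;b]}^g`. -/
def intervalTuple (a b : Fin d) (g : G) : Fin d → G := fun k => if a < k ∧ k ≤ b then g else 1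

/-- `Φ^e_X`: the sets almost invariant under `T_{(a;b]}^g` for all `g ∈ G` and all pairs `a < b` of
consecutive elements of `e`. -/
@[reducible] def Phi (e : Finset (Fin d)) (X : GSpace.{u} (Fin d → G)) : MeasurableSpace X.carrier :=
  almostInvariant X {h | ∃ a ∈ e, ∃ b ∈ e, a < b ∧ (∀ c ∈ e, ¬ (a < c ∧ c < b)) ∧
    ∃ g : G, h = intervalTuple a b g}

/-- `Φ^I_X`, the join of the `Φ^e_X` over `e ∈ I`. -/
@[reducible] def PhiJoin (I : Set (Finset (Fin d))) (X : GSpace.{u} (Fin d → G)) : MeasurableSpace X.carrier :=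
  ⨆ e ∈ I, Phi e X

/-- Sated for every join of finitely many `Φ^e` with `|e| ≥ 2`. -/
def IsFullySated (X : GSpace.{u} (Fin d → G)) : Prop :=
  ∀ I : Set (Finset (Fin d)), (∀ e ∈ I, 2 ≤ e.card) → IsSated (PhiJoin I) X

/-- The up-set `⟨i⟩` in the family of subsets of size at least two. -/
def upSetOf (i : Fin d) : Set (Finset (Fin d)) := {e | 2 ≤ e.card ∧ i ∈ e}

/-- A left Følner sequence of finite subsets of the discrete group `G`. -/
def IsLeftFolner (F : ℕ → Finset G) : Prop :=
  @IsFoelner G G ⊤ (@Measure.count G ⊤) _ _ ℕ atTop (fun n => (F n : Set G))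

/-- The average over `g ∈ F` of the law under `μ` of `(T_{[1;1]}^g x, …, T_{[1;d]}^g x)`. -/
def averageCoupling (X : GSpace.{u} (Fin d → G)) (F : Finset G) :
    Measure (Fin d → X.carrier) :=
  (F.card : ENNReal)⁻¹ • ∑ g ∈ F, X.μ.map (fun x i => X.T (initialTuple i g) x)

/-- `θ` is the limit of the average couplings along `F` in the space of `d`-fold couplings of `μ`,
with the topology of convergence on products of measurable sets. -/
structure IsLimitCoupling (X : GSpace.{u} (Fin d → G)) (F : ℕ → Finset G)
    (θ : Measure (Fin d → X.carrier)) : Prop where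
  isProbabilityMeasure : IsProbabilityMeasure θ
  marginal : ∀ i, θ.map (fun x => x i) = X.μ
  tendsto : ∀ A : Fin d → Set X.carrier, (∀ i, MeasurableSet (A i)) →
    Tendsto (fun n => averageCoupling X (F n) (Set.univ.pi A)) atTop (nhds (θ (Set.univ.pi A)))

end Tuples

section Oblique

variable {Ω : Type*} {d : ℕ}

/-- The completion of `m` within the ambient `σ`-algebra: the measurable sets that agree with a
member of `m` up to a `θ`-null set. -/
@[reducible] def relCompletion {mΩ : MeasurableSpace Ω} (θ : Measure Ω) (m : MeasurableSpace Ω) :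
    MeasurableSpace Ω :=
  eventuallyMeasurableSpace m (ae θ) ⊓ mΩ

/-- The lifts of the sets of `Ψ` through the coordinates `i ∈ e` agree up to `θ`-null sets. -/
def LiftsCoincide {mΩ : MeasurableSpace Ω} (θ : Measure (Fin d → Ω)) (e : Finset (Fin d))
    (Ψ : MeasurableSpace Ω) : Prop :=
  ∀ i ∈ e, ∀ j ∈ e, ∀ A : Set Ω, MeasurableSet[Ψ] A →
    θ (symmDiff ((fun x : Fin d → Ω => x i) ⁻¹' A) ((fun x : Fin d → Ω => x j) ⁻¹' A)) = 0

/-- The oblique copy of `Ψ`: the `θ`-completion of the lifts `π_i⁻¹(Ψ)`, `i ∈ e`. It is the common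
completion of the individual lifts when these coincide. -/
@[reducible] def obliqueCopy {mΩ : MeasurableSpace Ω} (θ : Measure (Fin d → Ω)) (e : Finset (Fin d))
    (Ψ : MeasurableSpace Ω) : MeasurableSpace (Fin d → Ω) :=
  ⨆ i ∈ e, relCompletion θ (Ψ.comap fun x => x i)

theorem obliqueCopy_eq {mΩ : MeasurableSpace Ω} {θ : Measure (Fin d → Ω)} {e : Finset (Fin d)}
    {Ψ : MeasurableSpace Ω} (h : LiftsCoincide θ e Ψ) {i : Fin d} (hi : i ∈ e) :
    obliqueCopy θ e Ψ = relCompletion θ (Ψ.comap fun x => x i) := by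
  refine le_antisymm (iSup₂_le fun j hj => ?_)
    (le_iSup₂_of_le (f := fun j _ => relCompletion θ (Ψ.comap fun x => x j)) i hi le_rfl)
  refine le_inf ?_ inf_le_right
  intro B hB
  obtain ⟨C, ⟨A, hA, rfl⟩, hBA⟩ := (MeasurableSpace.measurableSet_inf.1 hB).1
  exact ⟨_, ⟨A, hA, rfl⟩, hBA.trans (measure_symmDiff_eq_zero_iff.1 (h j hj i hi A hA))⟩

/-- The join of the oblique copies of `Ψ e` over `e ∈ I`. -/
@[reducible] def obliqueJoin {mΩ : MeasurableSpace Ω} (θ : Measure (Fin d → Ω))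
    (Ψ : Finset (Fin d) → MeasurableSpace Ω) (I : Set (Finset (Fin d))) :
    MeasurableSpace (Fin d → Ω) :=
  ⨆ e ∈ I, obliqueCopy θ e (Ψ e)

/-- The hypotheses of the infinitary removal lemma for the coupling `θ` and the
`σ`-subalgebras `Ψ e`, indexed by the `e` with at least two elements. -/
structure RemovalHypotheses {mΩ : MeasurableSpace Ω} (θ : Measure (Fin d → Ω))
    (Ψ : Finset (Fin d) → MeasurableSpace Ω) : Prop where
  le_ambient : ∀ e, 2 ≤ e.card → Ψ e ≤ mΩ
  nested : ∀ a e, 2 ≤ a.card → a ⊆ e → Ψ e ≤ Ψ a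
  diagonal : ∀ e, 2 ≤ e.card → LiftsCoincide θ e (Ψ e)
  relIndep : ∀ I J : Set (Finset (Fin d)), (∀ e ∈ I, 2 ≤ e.card) → (∀ e ∈ J, 2 ≤ e.card) →
    IsUpperSet I → IsUpperSet J →
    RelIndep θ (obliqueJoin θ Ψ I) (obliqueJoin θ Ψ J) (obliqueJoin θ Ψ (I ∩ J))

end Oblique

end

/-! Everything reduces to vanishing integrals: `Orth` says that a function has zero conditional
expectation on a σ-algebra. Satedness enters only through `exists_limit_measure_of_isSated`. Move
sets `B j` by words `w j a` in `G^d` and average `a` over the Følner sets `F_n^d`. The limit law of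
the orbit of a point, together with the moved copies, is an extension of `X` in which the events `B
j` at the moved copies become `Φ^(e j)`-measurable. Hence a function on `X` orthogonal to the join
of the `Φ^(e j)` is uncorrelated with the moved sets on average.

Two kinds of words are used. Since `T_{(s;k]}^{g⁻¹} T_{[1;k]}^g = T_{[1;s]}^g`, the coordinates of
the coupling below `k` are moved copies of coordinate `k`; this gives
`setIntegral_eq_zero_of_orth_top`. Words that fix all `Φ^e`-sets show that a `Φ^e`-measurable
function orthogonal to the `Φ^(e ∪ {k})`, with `k ∉ e` below `max e`, is orthogonal even to the
larger `Φ^{p,k}`, `p = min e`; this is `orth_pairs_of_orth_insert`.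

Induction on the largest coordinate combines the two: a `Φ^e`-measurable function of `x_p` that is
orthogonal to the `Φ^(e ∪ {k})`, `k ∈ c`, is orthogonal to all coordinates in `c` (`orth_singleton`,
`orth_coordJoin`). For `e = {p}` this gives the relative independence of the coordinates, replacing
one function at a time. For up-sets, the minimal elements of `I \ J` are removed one by one
(`orth_obliqueJoin`). The lifts of a `Φ^e`-set coincide because they already agree almost everywhere
in every average. -/

/-! ### Compactness of couplings for convergence on measurable boxes. -/

/-- The product of the sets `A i` over the coordinates `i ∈ s`. -/
def box {I X : Type*} (s : Finset I) (A : I → Set X) : Set (I → X) := {x | ∀ i ∈ s, x i ∈ A i}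

theorem measurableSet_box {I X : Type*} [MeasurableSpace X] (s : Finset I) {A : I → Set X}
    (hA : ∀ i, MeasurableSet (A i)) : MeasurableSet (box s A) := by
  have : box s A = ⋂ i ∈ s, (fun x : I → X => x i) ⁻¹' A i := by
    ext x; simp [box]
  rw [this]
  exact Finset.measurableSet_biInter s fun i _ => measurable_pi_apply i (hA i)

theorem abs_measureReal_box_sub_le {I X : Type*} [MeasurableSpace X] {μ : Measure X}
    {ν : Measure (I → X)} [IsFiniteMeasure ν] (hν : ∀ i, ν.map (fun x => x i) = μ)
    (s : Finset I) {A C : I → Set X} (hA : ∀ i, MeasurableSet (A i))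
    (hC : ∀ i, MeasurableSet (C i)) :
    |ν.real (box s A) - ν.real (box s C)| ≤ ∑ i ∈ s, μ.real (symmDiff (A i) (C i)) := by
  have hsub : symmDiff (box s A) (box s C) ⊆
      ⋃ i ∈ s, (fun x : I → X => x i) ⁻¹' symmDiff (A i) (C i) := by
    rintro x (⟨hx, hx'⟩ | ⟨hx, hx'⟩)
    · simp only [box, Set.mem_ofPred_eq, not_forall] at hx hx'
      obtain ⟨i, hi, hi'⟩ := hx'
      exact Set.mem_biUnion hi (Or.inl ⟨hx i hi, hi'⟩)
    · simp only [box, Set.mem_ofPred_eq, not_forall] at hx hx'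
      obtain ⟨i, hi, hi'⟩ := hx'
      exact Set.mem_biUnion hi (Or.inr ⟨hx i hi, hi'⟩)
  calc |ν.real (box s A) - ν.real (box s C)| ≤ ν.real (symmDiff (box s A) (box s C)) :=
        abs_measureReal_sub_le_measureReal_symmDiff' (measurableSet_box s hA).nullMeasurableSet
          (measurableSet_box s hC).nullMeasurableSet (measure_ne_top _ _) (measure_ne_top _ _)
    _ ≤ ν.real (⋃ i ∈ s, (fun x : I → X => x i) ⁻¹' symmDiff (A i) (C i)) :=
        measureReal_mono hsub (measure_ne_top _ _)
    _ ≤ ∑ i ∈ s, ν.real ((fun x : I → X => x i) ⁻¹' symmDiff (A i) (C i)) :=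
        measureReal_biUnion_finset_le _ _
    _ = _ := by
        refine Finset.sum_congr rfl fun i _ => ?_
        rw [← hν i, map_measureReal_apply (measurable_pi_apply i) ((hA i).symmDiff (hC i))]

theorem measureDense_isClopen (ρ : Measure (ℕ → Bool)) [IsFiniteMeasure ρ] :
    ρ.MeasureDense {C : Set (ℕ → Bool) | IsClopen C} := by
  refine Measure.MeasureDense.of_generateFrom_isSetAlgebra_finite ρ ?_ ?_
  · exact ⟨isClopen_empty, fun _ h => h.compl, fun _ _ h h' => h.union h'⟩
  · rw [BorelSpace.measurable_eq (α := ℕ → Bool)]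
    exact isTopologicalBasis_isClopen.borel_eq_generateFrom

/-- Weak compactness gives convergence on clopen boxes, whose boundary is empty. Because every
marginal is the same `ρ`, replacing measurable sides by clopen ones costs an error uniform in `n`,
so convergence passes to all measurable boxes. -/
theorem exists_coupling_limit_cantor {I : Type*} [Countable I] (ρ : Measure (ℕ → Bool))
    (U : Ultrafilter ℕ) (ν : ℕ → Measure (I → ℕ → Bool))
    [∀ n, IsProbabilityMeasure (ν n)] (hν : ∀ n i, (ν n).map (fun x => x i) = ρ)
    [IsProbabilityMeasure ρ] :
    ∃ ν' : Measure (I → ℕ → Bool), IsProbabilityMeasure ν' ∧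
      ∀ (s : Finset I) (A : I → Set (ℕ → Bool)), (∀ i, MeasurableSet (A i)) →
        Tendsto (fun n => (ν n).real (box s A)) U (nhds (ν'.real (box s A))) := by
  let P : ℕ → ProbabilityMeasure (I → ℕ → Bool) := fun n => ⟨ν n, inferInstance⟩
  obtain ⟨ν', -, hν'⟩ := isCompact_iff_ultrafilter_le_nhds.1
    (isCompact_univ (X := ProbabilityMeasure (I → ℕ → Bool))) (U.map P) (by simp)
  have hP : Tendsto P U (nhds ν') := hν'
  have hclopen : ∀ (s : Finset I) (C : I → Set (ℕ → Bool)), (∀ i, IsClopen (C i)) →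
      Tendsto (fun n => (ν n).real (box s C)) U (nhds ((ν' : Measure _).real (box s C))) := by
    intro s C hC
    have hbox : IsClopen (box s C) := by
      have : box s C = ⋂ i ∈ s, (fun x : I → ℕ → Bool => x i) ⁻¹' C i := by
        ext x; simp [box]
      rw [this]
      exact isClopen_biInter_finset fun i _ => (hC i).preimage (continuous_apply i)
    have := ProbabilityMeasure.tendsto_measure_of_null_frontier_of_tendsto' hP
      (E := box s C) (by rw [hbox.frontier_eq]; simp)
    exact (ENNReal.tendsto_toReal (measure_ne_top _ _)).comp this
  have hmarg : ∀ i, (ν' : Measure (I → ℕ → Bool)).map (fun x => x i) = ρ := by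
    intro i
    have : IsProbabilityMeasure ((ν' : Measure (I → ℕ → Bool)).map (fun x => x i)) :=
      Measure.isProbabilityMeasure_map (measurable_pi_apply i).aemeasurable
    refine ext_of_generate_finite {C : Set (ℕ → Bool) | IsClopen C} ?_ ?_ ?_ (by simp)
    · rw [BorelSpace.measurable_eq (α := ℕ → Bool)]
      exact isTopologicalBasis_isClopen.borel_eq_generateFrom
    · exact fun s hs t ht _ => hs.inter ht
    · intro C hC
      have h1 := hclopen {i} (fun _ => C) (fun _ => hC)
      have hb : box {i} (fun _ => C) = (fun x : I → ℕ → Bool => x i) ⁻¹' C := by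
        ext x; simp [box]
      have h2 : ∀ n, (ν n).real (box {i} (fun _ => C)) = ρ.real C := fun n => by
        rw [hb, ← hν n i, map_measureReal_apply (measurable_pi_apply i) hC.1.measurableSet]
      simp only [h2] at h1
      have h3 := tendsto_nhds_unique h1 tendsto_const_nhds
      rw [hb, ← map_measureReal_apply (measurable_pi_apply i) hC.1.measurableSet] at h3
      exact (measureReal_eq_measureReal_iff).1 h3
  refine ⟨ν', inferInstance, fun s A hA => ?_⟩
  rw [Metric.tendsto_nhds]
  intro ε hε
  -- The approximation error `card s * δ` occurs twice, for `ν n` and for `ν'`; the `+ 1` in the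
  -- witness covers empty `s`.
  obtain ⟨δ, hδ, hδε⟩ : ∃ δ : ℝ, 0 < δ ∧ 2 * (s.card * δ) < ε / 2 := by
    refine ⟨ε / (8 * (s.card + 1)), by positivity, ?_⟩
    have h : (s.card : ℝ) * (ε / (8 * (s.card + 1))) ≤ ε / 8 := by
      rw [mul_div_assoc', div_le_div_iff₀ (by positivity) (by norm_num)]
      nlinarith
    linarith
  choose C hC hAC using fun i =>
    (measureDense_isClopen ρ).approx (A i) (hA i) (measure_ne_top _ _) δ hδ
  have hsum : ∑ i ∈ s, ρ.real (symmDiff (A i) (C i)) ≤ s.card * δ := by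
    rw [← nsmul_eq_mul]
    refine Finset.sum_le_card_nsmul _ _ _ fun i _ => ?_
    exact ENNReal.toReal_le_of_le_ofReal hδ.le (hAC i).le
  have hCm := fun i => (hC i).1.measurableSet
  filter_upwards [Metric.tendsto_nhds.1 (hclopen s C hC) (ε / 2) (by positivity)] with n hn
  rw [Real.dist_eq] at hn ⊢
  have e1 := (abs_measureReal_box_sub_le (hν n) s hA hCm).trans hsum
  have e2 := (abs_measureReal_box_sub_le hmarg s hA hCm).trans hsum
  rw [abs_lt] at hn ⊢
  rw [abs_le] at e1 e2
  constructor <;> linarith [hn.1, hn.2, e1.1, e1.2, e2.1, e2.2]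

/-- Sequential compactness, along an ultrafilter, of the couplings of countably many copies of
`μ`, with respect to convergence on measurable boxes. -/
theorem exists_coupling_limit {X : Type*} [MeasurableSpace X] [StandardBorelSpace X]
    (μ : Measure X) [IsProbabilityMeasure μ] {I : Type*} [Countable I]
    (U : Ultrafilter ℕ) (ν : ℕ → Measure (I → X))
    [∀ n, IsProbabilityMeasure (ν n)] (hν : ∀ n i, (ν n).map (fun x => x i) = μ) :
    ∃ ν' : Measure (I → X), IsProbabilityMeasure ν' ∧
      ∀ (s : Finset I) (A : I → Set X), (∀ i, MeasurableSet (A i)) →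
        Tendsto (fun n => (ν n).real (box s A)) U (nhds (ν'.real (box s A))) := by
  have : Nonempty X := nonempty_of_isProbabilityMeasure μ
  -- Convergence on boxes is a purely measurable notion, so a Borel embedding into Cantor space with
  -- a measurable left inverse `R` transfers the result.
  have hE : MeasurableEmbedding (MeasurableSpace.mapNatBool X) :=
    (MeasurableSpace.measurable_mapNatBool X).measurableEmbedding
      (MeasurableSpace.injective_mapNatBool X)
  set E := MeasurableSpace.mapNatBool X
  obtain ⟨R, hR, hRE⟩ := hE.exists_measurable_extend measurable_id fun _ => inferInstance
  have hEm : Measurable fun (x : I → X) i => E (x i) :=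
    measurable_pi_lambda _ fun i => hE.measurable.comp (measurable_pi_apply i)
  have hRm : Measurable fun (x : I → ℕ → Bool) i => R (x i) :=
    measurable_pi_lambda _ fun i => hR.comp (measurable_pi_apply i)
  have : ∀ n, IsProbabilityMeasure ((ν n).map fun (x : I → X) i => E (x i)) := fun n =>
    Measure.isProbabilityMeasure_map hEm.aemeasurable
  have : IsProbabilityMeasure (μ.map E) := Measure.isProbabilityMeasure_map hE.measurable.aemeasurable
  obtain ⟨ν', hν'p, hν'⟩ := exists_coupling_limit_cantor (I := I) (μ.map E) U
    (fun n => (ν n).map fun (x : I → X) i => E (x i)) fun n i => by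
      rw [Measure.map_map (measurable_pi_apply i) hEm, ← hν n i,
        Measure.map_map hE.measurable (measurable_pi_apply i)]
      rfl
  refine ⟨ν'.map fun x i => R (x i), Measure.isProbabilityMeasure_map hRm.aemeasurable,
    fun s A hA => ?_⟩
  have h := hν' s (fun i => R ⁻¹' A i) fun i => hR (hA i)
  have hb : (fun (x : I → ℕ → Bool) i => R (x i)) ⁻¹' box s A = box s fun i => R ⁻¹' A i := rfl
  rw [map_measureReal_apply hRm (measurableSet_box s hA), hb]
  refine h.congr fun n => ?_
  rw [map_measureReal_apply hEm (measurableSet_box s fun i => hR (hA i))]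
  congr 1
  ext x
  have : ∀ y, R (E y) = y := fun y => congrFun hRE y
  simp [box, this]

/-! ### Functions with vanishing conditional expectation. -/

/-- `f` has vanishing conditional expectation on `m`: its integral over every `m`-measurable set
is zero. -/
def Orth {Ω : Type*} {mΩ : MeasurableSpace Ω} (μ : Measure Ω) (m : MeasurableSpace Ω)
    (f : Ω → ℝ) : Prop :=
  ∀ S, MeasurableSet[m] S → ∫ x in S, f x ∂μ = 0

section Orth

variable {Ω : Type*} {m m' mΩ : MeasurableSpace Ω} {μ : Measure Ω}
  {f g : Ω → ℝ}

theorem Orth.mono (h : Orth μ m' f) (hm : m ≤ m') : Orth μ m f := fun S hS => h S (hm S hS)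

theorem orth_of_isPiSystem {π : Set (Set Ω)} (hm : m ≤ mΩ) (hπ : IsPiSystem π)
    (hgen : m = MeasurableSpace.generateFrom π) (hf : Integrable f μ) (h0 : ∫ x, f x ∂μ = 0)
    (h : ∀ S ∈ π, ∫ x in S, f x ∂μ = 0) : Orth μ m f := by
  refine MeasurableSpace.induction_on_inter hgen hπ (by simp) h ?_ ?_
  · intro S hS hS0
    have := integral_add_compl (hm S hS) hf
    linarith
  · intro S hd hS hS0
    rw [integral_iUnion (fun i => hm _ (hS i)) hd hf.integrableOn]
    simp [hS0]

theorem orth_iSup {ι : Type*} (s : Finset ι) {n : ι → MeasurableSpace Ω} (hn : ∀ i ∈ s, n i ≤ mΩ)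
    (hf : Integrable f μ)
    (h : ∀ B : ι → Set Ω, (∀ i ∈ s, MeasurableSet[n i] (B i)) →
      ∫ x in ⋂ i ∈ s, B i, f x ∂μ = 0) : Orth μ (⨆ i ∈ s, n i) f := by
  classical
  have hgen := generateFrom_piiUnionInter_measurableSet n (s : Set ι)
  simp only [Finset.mem_coe] at hgen
  refine orth_of_isPiSystem (iSup₂_le hn)
    (isPiSystem_piiUnionInter _ (fun i => @MeasurableSpace.isPiSystem_measurableSet _ (n i)) _)
    hgen.symm hf ?_ ?_
  · simpa using h (fun _ => Set.univ) fun i _ => @MeasurableSet.univ _ (n i)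
  · rintro S ⟨t, hts, B, hB, rfl⟩
    have := h (fun i => if i ∈ t then B i else Set.univ) fun i _ => by
      by_cases hi : i ∈ t
      · simpa [hi] using hB i hi
      · simp [hi]
    convert this using 3
    ext x
    simp only [Set.mem_iInter]
    constructor
    · intro hx i _
      by_cases hi : i ∈ t
      · simpa [hi] using hx i hi
      · simp [hi]
    · intro hx i hi
      simpa [hi] using hx i (hts hi)

theorem orth_sup (hm : m ≤ mΩ) (hm' : m' ≤ mΩ) (hf : Integrable f μ)
    (h : ∀ S S', MeasurableSet[m] S → MeasurableSet[m'] S' → ∫ x in S ∩ S', f x ∂μ = 0) :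
    Orth μ (m ⊔ m') f := by
  have h1 : m ⊔ m' = ⨆ i ∈ (Finset.univ : Finset Bool), cond i m m' := by
    simp [iSup_bool_eq]
  rw [h1]
  refine orth_iSup _ (fun i _ => by cases i <;> simpa) hf fun B hB => ?_
  convert h (B true) (B false) (by simpa using hB true) (by simpa using hB false) using 3
  ext x
  simp [and_comm]

theorem Orth.condExp_ae_eq_zero [IsFiniteMeasure μ] (h : Orth μ m f) (hm : m ≤ mΩ)
    (hf : Integrable f μ) : μ[f | m] =ᵐ[μ] 0 := by
  refine (ae_eq_condExp_of_forall_setIntegral_eq hm hf (fun s _ _ => integrableOn_zero) ?_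
    aestronglyMeasurable_zero).symm
  intro S hS _
  simpa using (h S hS).symm

theorem Orth.integral_mul [IsFiniteMeasure μ] (h : Orth μ m f) (hm : m ≤ mΩ)
    (hf : Integrable f μ) (hg : Measurable[m] g) {C : ℝ} (hgC : ∀ x, |g x| ≤ C) :
    ∫ x, f x * g x ∂μ = 0 := by
  have hfg : Integrable (f * g) μ :=
    hf.mul_bdd (c := C) (hg.mono hm le_rfl).aestronglyMeasurable (ae_of_all _ hgC)
  have h1 := condExp_mul_of_stronglyMeasurable_right (m := m) (μ := μ)
    (Measurable.stronglyMeasurable hg) hfg hf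
  have h2 : ∫ x, (f * g) x ∂μ = 0 := by
    rw [← integral_condExp hm, integral_congr_ae h1]
    have : (μ[f | m] * g) =ᵐ[μ] 0 := by
      filter_upwards [h.condExp_ae_eq_zero hm hf] with x hx
      simp [hx]
    rw [integral_congr_ae this]
    simp
  simpa using h2

theorem Orth.indicator (h : Orth μ m f) (hm : m ≤ mΩ) {B : Set Ω} (hB : MeasurableSet[m] B) :
    Orth μ m (B.indicator f) := by
  intro S hS
  rw [setIntegral_indicator (hm B hB)]
  exact h _ (hS.inter hB)

/-- Truncating the conditional expectation at `±|C|` gives a version that is bounded everywhere, as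
the definitions of relative independence require. -/
theorem exists_bounded_projection [IsFiniteMeasure μ] (hm : m ≤ mΩ) (hf : Measurable f) {C : ℝ}
    (hfC : ∀ x, |f x| ≤ C) :
    ∃ q : Ω → ℝ, Measurable[m] q ∧ (∀ x, |q x| ≤ |C|) ∧ q =ᵐ[μ] μ[f | m] ∧
      Orth μ m (fun x => f x - q x) := by
  have hfi : Integrable f μ :=
    Integrable.of_bound hf.aestronglyMeasurable C (ae_of_all _ hfC)
  have hbd : ∀ᵐ x ∂μ, |(μ[f | m]) x| ≤ |C| :=
    ae_bdd_abs_condExp_of_ae_bdd_abs (ae_of_all _ fun x => (hfC x).trans (le_abs_self C))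
  have hq : (fun x => max (-|C|) (min |C| ((μ[f | m]) x))) =ᵐ[μ] μ[f | m] := by
    filter_upwards [hbd] with x hx
    rw [abs_le] at hx
    rw [min_eq_right hx.2, max_eq_right hx.1]
  refine ⟨_, ?_, fun x => ?_, hq, ?_⟩
  · exact measurable_const.max (measurable_const.min stronglyMeasurable_condExp.measurable)
  · rw [abs_le]
    exact ⟨le_max_left _ _, max_le (by linarith [abs_nonneg C]) (min_le_left _ _)⟩
  · intro S hS
    have hqi := integrable_condExp.congr hq.symm
    rw [integral_sub hfi.integrableOn hqi.integrableOn,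
      setIntegral_congr_ae (hm S hS) (hq.mono fun x hx _ => hx), setIntegral_condExp hm hfi hS,
      sub_self]

theorem orth_comap_iff {X : Type*} {n : MeasurableSpace X} [mX : MeasurableSpace X] {π : Ω → X}
    (hπ : Measurable π) (hn : n ≤ mX) {φ : X → ℝ} (hφ : Measurable φ) :
    Orth μ (n.comap π) (fun x => φ (π x)) ↔ Orth (μ.map π) n φ := by
  constructor
  · intro h S hS
    rw [setIntegral_map (hn S hS) hφ.aestronglyMeasurable hπ.aemeasurable]
    exact h _ ⟨S, hS, rfl⟩
  · rintro h _ ⟨S, hS, rfl⟩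
    rw [← h S hS, setIntegral_map (hn S hS) hφ.aestronglyMeasurable hπ.aemeasurable]

theorem Orth.relCompletion (h : Orth μ m f) : Orth μ (relCompletion μ m) f := by
  rintro S hS
  obtain ⟨S', hS', hSS'⟩ := (MeasurableSpace.measurableSet_inf.1 hS).1
  rw [setIntegral_congr_set hSS']
  exact h S' hS'

end Orth

/-! ### Averages over powers of a Følner sequence. -/

section Averages

/-- The average of `φ` over the finite set `E`. -/
noncomputable def finsetAverage {α : Type*} (E : Finset α) (φ : α → ℝ) : ℝ :=
  (E.card : ℝ)⁻¹ * ∑ a ∈ E, φ a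

theorem finsetAverage_const {α : Type*} {E : Finset α} (hE : E.Nonempty) {φ : α → ℝ} {c : ℝ}
    (h : ∀ a ∈ E, φ a = c) : finsetAverage E φ = c := by
  have : (E.card : ℝ) ≠ 0 := by exact_mod_cast hE.card_ne_zero
  rw [finsetAverage, Finset.sum_congr rfl h, Finset.sum_const, nsmul_eq_mul]
  field_simp

/-- The average over `a ∈ E` of the images of `μ` under `p a`. -/
noncomputable def averageMap {α X Y : Type*} [MeasurableSpace X] [MeasurableSpace Y]
    (μ : Measure X) (E : Finset α) (p : α → X → Y) : Measure Y :=
  (E.card : ENNReal)⁻¹ • ∑ a ∈ E, μ.map (p a)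

theorem averageMap_real {α X Y : Type*} [MeasurableSpace X] [MeasurableSpace Y]
    (μ : Measure X) [IsProbabilityMeasure μ] (E : Finset α) {p : α → X → Y}
    (hp : ∀ a, Measurable (p a)) {S : Set Y} (hS : MeasurableSet S) :
    (averageMap μ E p).real S = finsetAverage E fun a => μ.real (p a ⁻¹' S) := by
  rw [averageMap, measureReal_ennreal_smul_apply, finsetAverage, ENNReal.toReal_inv, ENNReal.toReal_natCast]
  congr 1
  rw [Measure.real, Measure.finsetSum_apply, ENNReal.toReal_sum]
  · refine Finset.sum_congr rfl fun a _ => ?_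
    rw [Measure.map_apply (hp a) hS, Measure.real]
  · intro a _
    rw [Measure.map_apply (hp a) hS]
    exact measure_ne_top _ _

theorem isProbabilityMeasure_averageMap {α X Y : Type*} [MeasurableSpace X] [MeasurableSpace Y]
    (μ : Measure X) [IsProbabilityMeasure μ] {E : Finset α} (hE : E.Nonempty) {p : α → X → Y}
    (hp : ∀ a, Measurable (p a)) : IsProbabilityMeasure (averageMap μ E p) := by
  constructor
  rw [averageMap, Measure.smul_apply, Measure.finsetSum_apply]
  have : ∀ a ∈ E, (μ.map (p a)) Set.univ = 1 := fun a _ => by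
    rw [Measure.map_apply (hp a) .univ, Set.preimage_univ, measure_univ]
  rw [Finset.sum_congr rfl this]
  simp only [Finset.sum_const, nsmul_eq_mul, mul_one, smul_eq_mul]
  exact ENNReal.inv_mul_cancel (by exact_mod_cast hE.card_ne_zero) (by simp)

variable {G : Type v} {d : ℕ}

theorem IsLeftFolner.eventually_nonempty [Group G] {F : ℕ → Finset G} (hF : IsLeftFolner F) :
    ∀ᶠ n in atTop, (F n).Nonempty := by
  let _ : MeasurableSpace G := ⊤
  have h := IsFoelner.eventually_meas_ne_zero hF
  filter_upwards [h] with n hn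
  rw [Finset.nonempty_iff_ne_empty]
  rintro h0
  simp [h0] at hn

open scoped Classical Pointwise in
theorem IsLeftFolner.tendsto_card_filter [Group G] {F : ℕ → Finset G} (hF : IsLeftFolner F) (g : G) :
    Tendsto (fun n => (((F n).filter fun b => g * b ∉ F n).card : ℝ) / (F n).card) atTop
      (nhds 0) := by
  let _ : MeasurableSpace G := ⊤
  have h := IsFoelner.tendsto_meas_smul_symmDiff hF g
  have h' := (ENNReal.tendsto_toReal ENNReal.zero_ne_top).comp h
  rw [ENNReal.toReal_zero] at h'
  refine squeeze_zero (fun n => by positivity) (fun n => ?_) h'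
  simp only [Function.comp_apply, ENNReal.toReal_div]
  have e1 : (Measure.count (F n : Set G)).toReal = (F n).card := by
    rw [Measure.count_apply_finset' (by trivial)]; simp
  have e2 : (((F n).filter fun b => g * b ∉ F n).card : ENNReal) ≤
      Measure.count (symmDiff (g • (F n : Set G)) (F n : Set G)) := by
    have hsub : ((((F n).filter fun b => g * b ∉ F n).image (g * ·) : Finset G) : Set G) ⊆
        symmDiff (g • (F n : Set G)) (F n : Set G) := by
      intro x hx
      simp only [Finset.coe_image, Finset.coe_filter, Set.mem_image, Set.mem_ofPred_eq] at hx
      obtain ⟨b, ⟨hb, hb'⟩, rfl⟩ := hx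
      exact Or.inl ⟨⟨b, hb, rfl⟩, hb'⟩
    refine le_trans ?_ (measure_mono hsub)
    rw [Measure.count_apply_finset' (by trivial),
      Finset.card_image_of_injective _ (mul_right_injective g)]
  have hfin : Measure.count (symmDiff (g • (F n : Set G)) (F n : Set G)) ≠ ⊤ := by
    refine (Measure.count_apply_lt_top' (by trivial)).2 ?_ |>.ne
    exact ((F n).finite_toSet.smul_set).symmDiff (F n).finite_toSet
  change _ ≤ (Measure.count (symmDiff (g • (F n : Set G)) (F n : Set G))).toReal /
    (Measure.count (F n : Set G)).toReal
  rw [e1]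
  gcongr
  simpa using ENNReal.toReal_mono hfin e2

/-- The `d`-th power of a finite set. -/
def power (d : ℕ) (F : Finset G) : Finset (Fin d → G) := Fintype.piFinset fun _ => F

theorem power_nonempty {F : Finset G} (hF : F.Nonempty) : (power d F).Nonempty := by
  simpa [power, Fintype.piFinset_nonempty] using fun _ => hF

/-- Averages over `F^d` are needed for invariance under all of `G^d`; words depending on one
coordinate only reduce them to the averages over `F` that define the coupling. -/
theorem finsetAverage_power_apply {F : Finset G} (hF : F.Nonempty) (k : Fin d) (φ : G → ℝ) :
    finsetAverage (power d F) (fun a => φ (a k)) = finsetAverage F φ := by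
  rw [finsetAverage, finsetAverage, power, Fintype.sum_piFinset_apply, Fintype.card_piFinset]
  have h0 : (F.card : ℝ) ≠ 0 := by exact_mod_cast hF.card_ne_zero
  obtain ⟨d, rfl⟩ : ∃ d', d = d' + 1 := ⟨d - 1, by have := k.pos; omega⟩
  simp only [Finset.prod_const, Finset.card_univ, Fintype.card_fin, Nat.cast_pow, nsmul_eq_mul,
    Nat.add_sub_cancel]
  field_simp
  ring

-- The sums differ by those over `γE \ E` and `E \ γE`, two sets of equal size. Since `0 ≤ φ ≤ 1`
-- these enter with opposite signs, so no factor 2 appears.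
open scoped Classical in
theorem abs_sum_mul_left_sub_le {H : Type*} [Group H] (E : Finset H) (γ : H) {φ : H → ℝ}
    (h0 : ∀ a, 0 ≤ φ a) (h1 : ∀ a, φ a ≤ 1) :
    |∑ a ∈ E, φ (γ * a) - ∑ a ∈ E, φ a| ≤ (E.filter fun a => γ * a ∉ E).card := by
  set D := E.image (γ * ·)
  have hD : ∑ a ∈ E, φ (γ * a) = ∑ a ∈ D, φ a :=
    (Finset.sum_image fun x _ y _ h => mul_left_cancel h).symm
  have hcard : D.card = E.card := Finset.card_image_of_injective _ (mul_right_injective γ)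
  have hDE : (D \ E).card = (E.filter fun a => γ * a ∉ E).card := by
    rw [← Finset.card_image_of_injective (E.filter fun a => γ * a ∉ E) (mul_right_injective γ)]
    congr 1
    ext x
    simp only [D, Finset.mem_sdiff, Finset.mem_image, Finset.mem_filter]
    constructor
    · rintro ⟨⟨a, ha, rfl⟩, h⟩; exact ⟨a, ⟨ha, h⟩, rfl⟩
    · rintro ⟨a, ⟨ha, h⟩, rfl⟩; exact ⟨⟨a, ha, rfl⟩, h⟩
  have hED : (E \ D).card = (D \ E).card := Finset.card_sdiff_comm hcard.symm
  have s1 := Finset.sum_sdiff_sub_sum_sdiff (s₁ := E) (s₂ := D) (f := φ)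
  have b1 : ∑ a ∈ D \ E, φ a ≤ (D \ E).card := by
    simpa using Finset.sum_le_card_nsmul (D \ E) φ 1 fun a _ => h1 a
  have b2 : ∑ a ∈ E \ D, φ a ≤ (E \ D).card := by
    simpa using Finset.sum_le_card_nsmul (E \ D) φ 1 fun a _ => h1 a
  have b3 : 0 ≤ ∑ a ∈ D \ E, φ a := Finset.sum_nonneg fun a _ => h0 a
  have b4 : 0 ≤ ∑ a ∈ E \ D, φ a := Finset.sum_nonneg fun a _ => h0 a
  rw [hD, ← hDE]
  rw [hED] at b2
  rw [abs_le]
  constructor <;> linarith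

/-- A tuple leaves `F^d` under `γ` only if some coordinate leaves `F`; a union bound over the `d`
coordinates reduces to the Følner property of `F`. -/
theorem IsLeftFolner.tendsto_finsetAverage_power_sub [Group G] {F : ℕ → Finset G} (hF : IsLeftFolner F)
    (γ : Fin d → G) {φ : (Fin d → G) → ℝ} (h0 : ∀ a, 0 ≤ φ a) (h1 : ∀ a, φ a ≤ 1) :
    Tendsto (fun n => finsetAverage (power d (F n)) (fun a => φ (γ * a)) - finsetAverage (power d (F n)) φ)
      atTop (nhds 0) := by
  classical
  have hlim : Tendsto (fun n => ∑ i : Fin d,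
      (((F n).filter fun b => γ i * b ∉ F n).card : ℝ) / (F n).card) atTop (nhds 0) := by
    simpa using tendsto_finsetSum Finset.univ fun i _ => hF.tendsto_card_filter (γ i)
  rw [tendsto_zero_iff_abs_tendsto_zero]
  refine squeeze_zero' (Eventually.of_forall fun n => abs_nonneg _) ?_ hlim
  filter_upwards [hF.eventually_nonempty] with n hn
  simp only [finsetAverage, Function.comp_apply]
  rw [← mul_sub, abs_mul, abs_inv, Nat.abs_cast, inv_mul_eq_div]
  have hpos : (0 : ℝ) < (power d (F n)).card := by exact_mod_cast (power_nonempty hn).card_pos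
  rw [div_le_iff₀ hpos]
  refine (abs_sum_mul_left_sub_le _ γ h0 h1).trans ?_
  have hsub : ((power d (F n)).filter fun a => γ * a ∉ power d (F n)) ⊆
      Finset.univ.biUnion fun i => (power d (F n)).filter fun a => γ i * a i ∉ F n := by
    intro a ha
    simp only [power, Finset.mem_filter, Fintype.mem_piFinset, not_forall, Pi.mul_apply,
      Finset.mem_biUnion, Finset.mem_univ, true_and] at ha ⊢
    obtain ⟨h, i, hi⟩ := ha
    exact ⟨i, h, hi⟩
  have hcard : ((((power d (F n)).filter fun a => γ * a ∉ power d (F n)).card : ℕ) : ℝ) ≤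
      ∑ i, (((power d (F n)).filter fun a => γ i * a i ∉ F n).card : ℝ) := by
    exact_mod_cast (Finset.card_le_card hsub).trans Finset.card_biUnion_le
  refine le_trans (le_of_eq (by congr!)) (hcard.trans (le_of_eq ?_))
  rw [Finset.sum_mul]
  refine Finset.sum_congr rfl fun i _ => ?_
  have h2 := finsetAverage_power_apply hn i fun b => if γ i * b ∉ F n then (1 : ℝ) else 0
  simp only [finsetAverage, Finset.sum_boole] at h2
  rw [inv_mul_eq_div, inv_mul_eq_div, div_eq_iff hpos.ne'] at h2
  exact h2

end Averages

/-! ### Limits of averaged laws. -/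

theorem ext_of_box {I X : Type*} [MeasurableSpace X] {ν ν' : Measure (I → X)}
    [IsProbabilityMeasure ν] [IsProbabilityMeasure ν']
    (h : ∀ (s : Finset I) (A : I → Set X), (∀ i, MeasurableSet (A i)) →
      ν.real (box s A) = ν'.real (box s A)) : ν = ν' := by
  refine ext_of_generate_finite _ generateFrom_squareCylinders.symm
    (isPiSystem_squareCylinders (fun i => MeasurableSpace.isPiSystem_measurableSet)
      fun i => MeasurableSet.univ) ?_ (by simp)
  rintro S ⟨s, t, ht, rfl⟩
  exact (measureReal_eq_measureReal_iff).1 (h s t fun i => ht i trivial)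

theorem exists_averageMap_limit {X : Type*} [MeasurableSpace X] [StandardBorelSpace X]
    (μ : Measure X) [IsProbabilityMeasure μ] {I α : Type*} [Countable I]
    (U : Ultrafilter ℕ) {E : ℕ → Finset α} (hE : ∀ᶠ n in U, (E n).Nonempty)
    {p : α → X → I → X} (hp : ∀ a i, MeasurePreserving (fun x => p a x i) μ μ) :
    ∃ ν : Measure (I → X), IsProbabilityMeasure ν ∧ (∀ i, ν.map (fun z => z i) = μ) ∧
      ∀ (s : Finset I) (A : I → Set X), (∀ i, MeasurableSet (A i)) →
        Tendsto (fun n => finsetAverage (E n) fun a => μ.real {x | ∀ i ∈ s, p a x i ∈ A i}) U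
          (nhds (ν.real (box s A))) := by
  classical
  obtain ⟨n₀, hn₀⟩ := hE.exists
  have hpm : ∀ a, Measurable (p a) := fun a => measurable_pi_lambda _ fun i => (hp a i).measurable
  -- Finitely or negligibly many `E n` may be empty; they are replaced by a nonempty one so that
  -- every average is a probability measure.
  let E' : ℕ → Finset α := fun n => if (E n).Nonempty then E n else E n₀
  have hE' : ∀ n, (E' n).Nonempty := fun n => by
    by_cases h : (E n).Nonempty <;> simp [E', h, hn₀]
  have := fun n => isProbabilityMeasure_averageMap μ (hE' n) hpm
  have hmarg : ∀ n i, (averageMap μ (E' n) p).map (fun z => z i) = μ := by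
    intro n i
    have := Measure.isProbabilityMeasure_map (μ := averageMap μ (E' n) p)
      (measurable_pi_apply (X := fun _ : I => X) i).aemeasurable
    ext S hS
    rw [← measureReal_eq_measureReal_iff, map_measureReal_apply (measurable_pi_apply i) hS,
      averageMap_real μ _ hpm (measurable_pi_apply i hS)]
    refine finsetAverage_const (hE' n) fun a _ => ?_
    exact (hp a i).measureReal_preimage hS.nullMeasurableSet
  obtain ⟨ν, hν, hlim⟩ := exists_coupling_limit μ U (fun n => averageMap μ (E' n) p) hmarg
  refine ⟨ν, hν, fun i => ?_, fun s A hA => ?_⟩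
  · have := Measure.isProbabilityMeasure_map (μ := ν)
      (measurable_pi_apply (X := fun _ : I => X) i).aemeasurable
    ext S hS
    have h1 := hlim {i} (fun _ => S) fun _ => hS
    have hb : box {i} (fun _ => S) = (fun x : I → X => x i) ⁻¹' S := by
      ext x; simp [box]
    have h2 : ∀ n, (averageMap μ (E' n) p).real (box {i} (fun _ => S)) = μ.real S := fun n => by
      rw [hb, ← map_measureReal_apply (measurable_pi_apply i) hS, hmarg]
    simp only [h2] at h1
    have h3 := tendsto_nhds_unique h1 tendsto_const_nhds
    rw [hb, ← map_measureReal_apply (measurable_pi_apply i) hS] at h3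
    exact (measureReal_eq_measureReal_iff).1 h3
  · refine (hlim s A hA).congr' ?_
    filter_upwards [hE] with n hn
    rw [averageMap_real μ _ hpm (measurableSet_box s hA)]
    simp only [E', hn, if_true]
    rfl

/-- The event `z i ∈ A`, `z j ∉ B` is a measurable box of mass zero in every average, hence null in
the limit. -/
theorem ae_eq_of_tendsto_box {X : Type*} [MeasurableSpace X]
    {μ : Measure X} [IsProbabilityMeasure μ] {I α : Type*} {U : Ultrafilter ℕ}
    {E : ℕ → Finset α} {p : α → X → I → X} {ν : Measure (I → X)} [IsProbabilityMeasure ν]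
    (hlim : ∀ (s : Finset I) (A : I → Set X), (∀ i, MeasurableSet (A i)) →
        Tendsto (fun n => finsetAverage (E n) fun a => μ.real {x | ∀ i ∈ s, p a x i ∈ A i}) U
          (nhds (ν.real (box s A)))) (i j : I) {A B : Set X} (hA : MeasurableSet A)
    (hB : MeasurableSet B)
    (h : ∀ a, {x | p a x i ∈ A} =ᵐ[μ] {x | p a x j ∈ B}) :
    (fun z : I → X => z i) ⁻¹' A =ᵐ[ν] (fun z : I → X => z j) ⁻¹' B := by
  classical
  have key : ∀ (i j : I) (A B : Set X), MeasurableSet A → MeasurableSet B →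
      (∀ a, {x | p a x i ∈ A} =ᵐ[μ] {x | p a x j ∈ B}) →
      (fun z : I → X => z i) ⁻¹' A ≤ᵐ[ν] (fun z : I → X => z j) ⁻¹' B := by
    intro i j A B hA hB h
    -- Intersecting the two conditions at each coordinate also handles `i = j`.
    have h1 := hlim {i, j} (fun k => (if k = i then A else Set.univ) ∩
      (if k = j then Bᶜ else Set.univ)) fun k => by
        refine MeasurableSet.inter ?_ ?_ <;> split_ifs <;>
        first | assumption | exact hB.compl | exact .univ
    have h2 : ∀ a, μ.real {x | ∀ k ∈ ({i, j} : Finset I), p a x k ∈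
        (if k = i then A else Set.univ) ∩ (if k = j then Bᶜ else Set.univ)} = 0 := by
      intro a
      rw [measureReal_def, ENNReal.toReal_eq_zero_iff]
      left
      refine measure_mono_null ?_ (ae_le_set.1 (h a).le)
      intro x hx
      simp only [Set.mem_ofPred_eq, Finset.mem_insert, Finset.mem_singleton, forall_eq_or_imp,
        forall_eq, Set.mem_inter_iff, if_true] at hx
      exact ⟨hx.1.1, hx.2.2⟩
    simp only [h2, finsetAverage, Finset.sum_const_zero, mul_zero] at h1
    have h3 := tendsto_nhds_unique h1 tendsto_const_nhds
    rw [measureReal_eq_zero_iff] at h3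
    rw [ae_le_set]
    refine measure_mono_null ?_ h3
    rintro z ⟨hz, hz'⟩ k hk
    refine ⟨?_, ?_⟩
    · split_ifs with hki
      · subst hki; exact hz
      · trivial
    · split_ifs with hkj
      · subst hkj; exact hz'
      · trivial
  exact (key i j A B hA hB h).antisymm (key j i B A hB hA fun a => (h a).symm)

/-! ### The extension carrying an orbit and its moved copies. -/

section Extension

variable {G : Type v} [Group G] [Countable G] {d : ℕ}

/-- The index set of the extension built from a limit of translates: a copy of `G^d × Option J`. -/
abbrev OrbitIndex (G : Type v) [Countable G] (d : ℕ) (J : Type) : Type :=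
  Shrink.{0} (Fin d → G) × Option J

instance {J : Type} [Countable J] : Countable (OrbitIndex G d J) :=
  have : Countable (Shrink.{0} (Fin d → G)) := Countable.of_equiv _ (equivShrink (Fin d → G))
  inferInstanceAs (Countable (Shrink.{0} (Fin d → G) × Option J))

/-- Right translation by `γ` on the first factor of the index set. -/
noncomputable def orbitShift {J : Type} (γ : Fin d → G) : OrbitIndex G d J ≃ OrbitIndex G d J :=
  (((equivShrink (Fin d → G)).symm.trans (Equiv.mulRight γ)).trans
    (equivShrink (Fin d → G))).prodCongr (Equiv.refl _)

theorem orbitShift_apply {J : Type} (γ δ : Fin d → G) (o : Option J) :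
    orbitShift γ (equivShrink _ δ, o) = (equivShrink _ (δ * γ), o) := by
  simp [orbitShift]

/-- The word acting at the index `(γ, o)` when the averaging parameter is `a`. -/
noncomputable def orbitWord {J : Type} (w : J → (Fin d → G) → (Fin d → G)) (a : Fin d → G)
    (i : OrbitIndex G d J) : Fin d → G :=
  match i.2 with
  | none => (equivShrink _).symm i.1
  | some j => w j ((equivShrink _).symm i.1 * a) * (equivShrink _).symm i.1

/-- Shifting the index by `γ` amounts to starting from `T^γ x` with parameter `γ * a`. The first
change is absorbed by invariance of `μ`, the second by the Følner property. -/
theorem orbitWord_shift {J : Type} (w : J → (Fin d → G) → (Fin d → G)) (a γ : Fin d → G)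
    (i : OrbitIndex G d J) :
    orbitWord w a (orbitShift γ i) = orbitWord w (γ * a) i * γ := by
  obtain ⟨s, o⟩ := i
  obtain ⟨δ, rfl⟩ := (equivShrink (Fin d → G)).surjective s
  rw [orbitShift_apply]
  cases o <;> simp [orbitWord, mul_assoc]

theorem orbitWord_one_none {J : Type} (w : J → (Fin d → G) → (Fin d → G)) (a : Fin d → G) :
    orbitWord w a (equivShrink _ 1, none) = 1 := by
  simp only [orbitWord, Equiv.symm_apply_apply]

theorem orbitWord_one_some {J : Type} (w : J → (Fin d → G) → (Fin d → G)) (a : Fin d → G) (j : J) :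
    orbitWord w a (equivShrink _ 1, some j) = w j a := by
  simp only [orbitWord, Equiv.symm_apply_apply, one_mul, mul_one]

theorem GSpace.measurable_T {Γ : Type v} [Group Γ] (X : GSpace.{u} Γ) (g : Γ) :
    Measurable (X.T g) := (X.measurePreserving g).measurable

/-- The coordinate shift on `OrbitIndex G d J → X` as a `GSpace`, for an invariant measure. -/
noncomputable def shiftSpace (X : GSpace.{u} (Fin d → G)) {J : Type} [Countable J]
    (ν : Measure (OrbitIndex G d J → X.carrier)) (hν : IsProbabilityMeasure ν)
    (hinv : ∀ γ : Fin d → G, ν.map (fun z i => z (orbitShift γ i)) = ν) :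
    GSpace.{u} (Fin d → G) where
  -- `Shrink` puts the index set in `Type`, so the carrier stays in the universe of `X`, as
  -- `IsSated` demands.
  carrier := OrbitIndex G d J → X.carrier
  μ := ν
  T γ z i := z (orbitShift γ i)
  T_one z := by
    ext ⟨s, o⟩
    obtain ⟨δ, rfl⟩ := (equivShrink (Fin d → G)).surjective s
    simp [orbitShift_apply]
  T_mul g h z := by
    ext ⟨s, o⟩
    obtain ⟨δ, rfl⟩ := (equivShrink (Fin d → G)).surjective s
    simp only [orbitShift_apply, mul_assoc]
  measurePreserving γ :=
    ⟨measurable_pi_lambda _ fun i => measurable_pi_apply (orbitShift γ i), hinv γ⟩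

/-- The elements of `G^d` whose action has to fix the sets of `Φ^e`. -/
def PhiGen (G : Type v) [Group G] {d : ℕ} (e : Finset (Fin d)) : Set (Fin d → G) :=
  {h | ∃ a ∈ e, ∃ b ∈ e, a < b ∧ (∀ c ∈ e, ¬ (a < c ∧ c < b)) ∧ ∃ g : G, h = intervalTuple a b g}

/-- In a sated space, a function with vanishing conditional expectation on `Φ^I` is, on average,
uncorrelated with sets `B j` that are moved by words `w j a` in such a way that they become
`Φ^(e j)`-measurable in a suitable extension. -/
theorem exists_limit_measure_of_isSated {F : ℕ → Finset G} (hF : IsLeftFolner F)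
    (X : GSpace.{u} (Fin d → G)) {I : Set (Finset (Fin d))} (hX : IsSated (PhiJoin I) X)
    {J : Type} [Fintype J] (e : J → Finset (Fin d)) (he : ∀ j, e j ∈ I)
    (B : J → Set X.carrier) (hB : ∀ j, MeasurableSet (B j))
    (w : J → (Fin d → G) → (Fin d → G))
    (hw : ∀ j, ∀ γ ∈ PhiGen G (e j), ∀ c,
      X.T (w j (γ * c) * γ) ⁻¹' B j =ᵐ[X.μ] X.T (w j c) ⁻¹' B j) :
    ∃ κ : Measure X.carrier, IsFiniteMeasure κ ∧
      (∀ A, MeasurableSet A →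
        Tendsto (fun n => finsetAverage (power d (F n)) fun a =>
          X.μ.real (A ∩ ⋂ j, X.T (w j a) ⁻¹' B j)) (hyperfilter ℕ) (nhds (κ.real A))) ∧
      ∀ f : X.carrier → ℝ, Measurable f → (∃ C, ∀ x, |f x| ≤ C) →
        Orth X.μ (PhiJoin I X) f → ∫ x, f x ∂κ = 0 := by
  classical
  let one : Shrink.{0} (Fin d → G) := equivShrink _ 1
  let p : (Fin d → G) → X.carrier → OrbitIndex G d J → X.carrier :=
    fun a x i => X.T (orbitWord w a i) x
  have hUtop : (hyperfilter ℕ : Filter ℕ) ≤ atTop := Nat.hyperfilter_le_atTop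
  obtain ⟨ν, hν, hmarg, hlim⟩ := exists_averageMap_limit X.μ (hyperfilter ℕ)
    (E := fun n => power d (F n))
    ((hF.eventually_nonempty.mono fun n hn => power_nonempty hn).filter_mono hUtop)
    (p := p) fun a i => X.measurePreserving _
  have hinv : ∀ γ : Fin d → G, ν.map (fun z i => z (orbitShift γ i)) = ν := by
    intro γ
    have hm : Measurable fun (z : OrbitIndex G d J → X.carrier) i => z (orbitShift γ i) :=
      measurable_pi_lambda _ fun i => measurable_pi_apply (orbitShift γ i)
    have := Measure.isProbabilityMeasure_map (μ := ν) hm.aemeasurable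
    refine ext_of_box fun s A hA => ?_
    rw [map_measureReal_apply hm (measurableSet_box s hA)]
    have hbox : (fun (z : OrbitIndex G d J → X.carrier) i => z (orbitShift γ i)) ⁻¹' box s A =
        box (s.image (orbitShift γ)) fun i => A ((orbitShift γ).symm i) := by
      ext z
      simp only [box, Set.mem_preimage, Set.mem_ofPred_eq, Finset.forall_mem_image,
        Equiv.symm_apply_apply]
    rw [hbox]
    have h1 := hlim (s.image (orbitShift γ)) (fun i => A ((orbitShift γ).symm i)) fun i => hA _
    have h2 := hlim s A hA
    have h3 := (hF.tendsto_finsetAverage_power_sub γ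
      (φ := fun a => X.μ.real {x | ∀ i ∈ s, p a x i ∈ A i}) (fun a => measureReal_nonneg)
      fun a => measureReal_le_one).mono_left hUtop
    have h4 : ∀ a, X.μ.real {x | ∀ i ∈ s.image (orbitShift γ), p a x i ∈
        A ((orbitShift γ).symm i)} = X.μ.real {x | ∀ i ∈ s, p (γ * a) x i ∈ A i} := by
      intro a
      have hms : MeasurableSet {x | ∀ i ∈ s, p (γ * a) x i ∈ A i} := by
        have : {x | ∀ i ∈ s, p (γ * a) x i ∈ A i} = ⋂ i ∈ s, X.T (orbitWord w (γ * a) i) ⁻¹' A i := by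
          ext x; simp [p]
        rw [this]
        exact Finset.measurableSet_biInter s fun i _ => X.measurable_T _ (hA i)
      rw [← (X.measurePreserving γ).measureReal_preimage hms.nullMeasurableSet]
      congr 1
      ext x
      simp only [p, Set.mem_preimage, Set.mem_ofPred_eq, Finset.forall_mem_image,
        Equiv.symm_apply_apply, orbitWord_shift, X.T_mul]
    simp only [h4] at h1
    have h5 := h1.sub h2
    exact sub_eq_zero.1 (tendsto_nhds_unique h5 h3)
  let Z := shiftSpace X ν hν hinv
  let ξ : Z.carrier → X.carrier := fun z => z (one, none)
  have hξm : Measurable ξ := measurable_pi_apply _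
  have hξ : IsFactorMap Z X ξ := by
    refine ⟨⟨hξm, hmarg _⟩, fun γ => ?_⟩
    -- At every finite stage the coordinate at `(γ, none)` is exactly `T^γ` of the one at `(1,
    -- none)`; the limit keeps this almost everywhere, tested set by set.
    refine EventuallyEq.of_forall_separating_preimage MeasurableSet fun A hA => ?_
    refine ae_eq_of_tendsto_box hlim (one, none) (orbitShift γ (one, none))
      (X.measurable_T γ hA) hA fun a => ?_
    have : {x | p a x (one, none) ∈ X.T γ ⁻¹' A} = {x | p a x (orbitShift γ (one, none)) ∈ A} := by
      ext x
      simp only [p, one, orbitWord_shift, orbitWord_one_none, one_mul, X.T_one, Set.mem_preimage,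
        Set.mem_ofPred_eq]
    exact this ▸ EventuallyEq.rfl
  -- Shifting the coordinate `(1, some j)` by a generator `γ` turns the word `w j a` into `w j (γ *
  -- a) * γ`; by `hw` this leaves the event `B j` unchanged up to null sets.
  have hS : ∀ j, MeasurableSet[Phi (e j) Z] ((fun z : Z.carrier => z (one, some j)) ⁻¹' B j) := by
    intro j
    refine ⟨measurable_pi_apply _ (hB j), fun γ hγ => ?_⟩
    refine ae_eq_of_tendsto_box hlim (orbitShift γ (one, some j)) (one, some j) (hB j) (hB j)
      fun a => ?_
    have e1 : {x | p a x (orbitShift γ (one, some j)) ∈ B j} = X.T (w j (γ * a) * γ) ⁻¹' B j := by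
      ext x
      simp only [p, one, orbitWord_shift, orbitWord_one_some, Set.mem_preimage, Set.mem_ofPred_eq]
    have e2 : {x | p a x (one, some j) ∈ B j} = X.T (w j a) ⁻¹' B j := by
      ext x
      simp only [p, one, orbitWord_one_some, Set.mem_preimage, Set.mem_ofPred_eq]
    have h1 := hw j γ hγ a
    rw [← e1, ← e2] at h1
    exact h1
  set S : Set Z.carrier := ⋂ j, ((fun z : Z.carrier => z (one, some j)) ⁻¹' B j)
  have hSm : MeasurableSet[PhiJoin I Z] S :=
    MeasurableSet.iInter fun j => (le_iSup₂_of_le (f := fun e _ => Phi e Z) (e j) (he j) le_rfl) _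
      (hS j)
  have hsat := hX Z ξ hξ
  have hSm' : MeasurableSet S := hsat.right_le _ hSm
  have hPhiX : PhiJoin I X ≤ X.measurableSpace := iSup₂_le fun e _ A hA => hA.1
  refine ⟨(Z.μ.restrict S).map ξ, Measure.isFiniteMeasure_map _ _, fun A hA => ?_, fun f hf ⟨C, hfC⟩ hfO => ?_⟩
  · rw [map_measureReal_apply hξm hA, measureReal_restrict_apply (hξm hA)]
    let A' : OrbitIndex G d J → Set X.carrier := fun i =>
      match i.2 with
      | none => A
      | some j => B j
    have h1 := hlim (Finset.univ.image fun o : Option J => (one, o)) A' fun i => by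
      rcases i with ⟨s, _ | j⟩
      · exact hA
      · exact hB j
    have hforall : ∀ P : OrbitIndex G d J → Prop,
        (∀ i ∈ Finset.univ.image fun o : Option J => (one, o), P i) ↔
          P (one, none) ∧ ∀ j, P (one, some j) := by
      intro P
      simp only [Finset.forall_mem_image, Finset.mem_univ, true_imp_iff, Option.forall]
    have e1 : ξ ⁻¹' A ∩ S = box (Finset.univ.image fun o : Option J => (one, o)) A' := by
      ext z
      refine Iff.trans ?_ (hforall fun i => z i ∈ A' i).symm
      simp only [Set.mem_inter_iff, S, Set.mem_iInter]
      rfl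
    rw [e1]
    change Tendsto _ _ (nhds (ν.real _))
    refine h1.congr fun n => ?_
    congr 1
    ext a
    congr 1
    ext x
    refine (hforall fun i => p a x i ∈ A' i).trans ?_
    simp only [p, A', one, orbitWord_one_none, orbitWord_one_some, X.T_one, Set.mem_inter_iff,
      Set.mem_iInter, Set.mem_preimage]
  -- Satedness applied to `f ∘ ξ` and the indicator of `S`: the conditional expectation of `f ∘ ξ`
  -- on the lift of `Φ^I_X` vanishes.
  · have h1 := hsat.integral_mul (fun z => f (ξ z)) (S.indicator fun _ => 1)
      (hf.comp (comap_measurable ξ)) (measurable_const.indicator hSm) ⟨C, fun z => hfC _⟩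
      ⟨1, fun z => by by_cases hz : z ∈ S <;> simp [hz]⟩
    have hO : Orth Z.μ ((PhiJoin I X).comap ξ) (fun z => f (ξ z)) := by
      rw [orth_comap_iff hξm hPhiX hf, hξ.measurePreserving.map_eq]
      exact hfO
    have hfi : Integrable (fun z => f (ξ z)) Z.μ :=
      Integrable.of_bound (hf.comp hξm).aestronglyMeasurable C (ae_of_all _ fun z => hfC _)
    have h0 := hO.condExp_ae_eq_zero (hsat.le_left.trans hsat.left_le) hfi
    replace h1 := h1.trans (integral_eq_zero_of_ae (h0.mono fun z hz => by
      simp only [Pi.zero_apply] at hz ⊢; rw [hz, zero_mul]))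
    rw [integral_map hξm.aemeasurable hf.aestronglyMeasurable, ← integral_indicator hSm']
    rw [← h1]
    refine integral_congr_ae (ae_of_all _ fun z => ?_)
    by_cases hz : z ∈ S <;> simp [hz]

end Extension

/-! ### Words in `G^d` and their effect on `Φ^e`-sets. -/

section Words

variable {G : Type v} [Group G] {d : ℕ}

theorem intervalTuple_mul_intervalTuple {a b c : Fin d} (hab : a ≤ b) (hbc : b ≤ c) (g : G) :
    intervalTuple a b g * intervalTuple b c g = intervalTuple a c g := by
  simp only [Fin.le_def] at hab hbc
  funext l
  simp only [intervalTuple, Pi.mul_apply, Fin.lt_def, Fin.le_def]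
  split_ifs <;> first | omega | simp

theorem intervalTuple_mul_initialTuple {a b : Fin d} (hab : a ≤ b) (g : G) :
    intervalTuple a b g * initialTuple a g = initialTuple b g := by
  simp only [Fin.le_def] at hab
  funext l
  simp only [intervalTuple, initialTuple, Pi.mul_apply, Fin.lt_def, Fin.le_def]
  split_ifs <;> first | omega | simp

theorem intervalTuple_inv_mul_initialTuple {a b : Fin d} (hab : a ≤ b) (g : G) :
    intervalTuple a b g⁻¹ * initialTuple b g = initialTuple a g := by
  simp only [Fin.le_def] at hab
  funext l
  simp only [intervalTuple, initialTuple, Pi.mul_apply, Fin.lt_def, Fin.le_def]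
  split_ifs <;> first | omega | simp

theorem intervalTuple_of_le {a b : Fin d} (hab : b ≤ a) (g : G) : intervalTuple a b g = 1 := by
  simp only [Fin.le_def] at hab
  funext l
  simp only [intervalTuple, Pi.one_apply, Fin.lt_def, Fin.le_def]
  split_ifs <;> first | omega | simp

theorem GSpace.preimage_mul {Γ : Type v} [Group Γ] (X : GSpace.{u} Γ) (g h : Γ)
    (B : Set X.carrier) : X.T (g * h) ⁻¹' B = X.T h ⁻¹' (X.T g ⁻¹' B) := by
  ext x; simp [X.T_mul]

theorem Phi_le (e : Finset (Fin d)) (X : GSpace.{u} (Fin d → G)) : Phi e X ≤ X.measurableSpace :=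
  fun _ h => h.1

/-- Chaining consecutive elements of `e` gives invariance for any two of them; for `b ≤ a` the tuple
is trivial. -/
theorem preimage_intervalTuple_ae_eq {X : GSpace.{u} (Fin d → G)} {e : Finset (Fin d)}
    {B : Set X.carrier} (hB : MeasurableSet[Phi e X] B) {a b : Fin d} (ha : a ∈ e) (hb : b ∈ e)
    (g : G) : X.T (intervalTuple a b g) ⁻¹' B =ᵐ[X.μ] B := by
  induction hn : (b : ℕ) - a using Nat.strong_induction_on generalizing a b with
  | _ n ih =>
  by_cases hab : a < b
  · by_cases hc : ∃ c ∈ e, a < c ∧ c < b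
    · obtain ⟨c, hc, hac, hcb⟩ := hc
      rw [← intervalTuple_mul_intervalTuple hac.le hcb.le, X.preimage_mul]
      have h1 := ih _ (by simp only [Fin.lt_def] at *; omega) ha hc rfl
      have h2 := ih _ (by simp only [Fin.lt_def] at *; omega) hc hb rfl
      exact ((X.measurePreserving _).quasiMeasurePreserving.preimage_ae_eq h1).trans h2
    · push Not at hc
      exact hB.2 _ ⟨a, ha, b, hb, hab, fun c hce h => absurd h.2 (not_lt.2 (hc c hce h.1)), g, rfl⟩
  · rw [intervalTuple_of_le (not_lt.1 hab)]
    have : X.T 1 ⁻¹' B = B := by ext x; simp [X.T_one]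
    rw [this]
    exact EventuallyEq.rfl

theorem Phi_mono {a e : Finset (Fin d)} (h : a ⊆ e) (X : GSpace.{u} (Fin d → G)) :
    Phi e X ≤ Phi a X := by
  rintro B hB
  refine ⟨hB.1, ?_⟩
  rintro _ ⟨u, hu, v, hv, -, -, g, rfl⟩
  exact preimage_intervalTuple_ae_eq hB (h hu) (h hv) g

theorem preimage_word_ae_eq {X : GSpace.{u} (Fin d → G)} {e : Finset (Fin d)}
    {B : Set X.carrier} (hB : MeasurableSet[Phi e X] B) {w w' : Fin d → G}
    (h : ∃ a ∈ e, ∃ b ∈ e, ∃ g : G, w' = intervalTuple a b g * w) :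
    X.T w' ⁻¹' B =ᵐ[X.μ] X.T w ⁻¹' B := by
  obtain ⟨a, ha, b, hb, g, rfl⟩ := h
  rw [X.preimage_mul]
  exact (X.measurePreserving w).quasiMeasurePreserving.preimage_ae_eq
    (preimage_intervalTuple_ae_eq hB ha hb g)

/-- A word pushing a `Φ^e`-set from coordinate `p ∈ e` to coordinate `k` above `e` makes it
`Φ^(e ∪ {k})`-measurable. -/
theorem interval_word_push {e : Finset (Fin d)} {p k : Fin d} (hp : p ∈ e) (hk : ∀ i ∈ e, i < k)
    {γ : Fin d → G} (hγ : γ ∈ PhiGen G (insert k e)) (c : Fin d → G) :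
    ∃ a ∈ e, ∃ b ∈ e, ∃ g : G, intervalTuple p k ((γ * c) k)⁻¹ * γ =
      intervalTuple a b g * intervalTuple p k (c k)⁻¹ := by
  obtain ⟨u, hu, v, hv, huv, hcons, h, rfl⟩ := hγ
  have hpk := hk p hp
  have hune : u ≠ k := by
    rintro rfl
    rcases Finset.mem_insert.1 hv with rfl | hv
    · exact lt_irrefl _ huv
    · exact lt_asymm huv (hk v hv)
  have hue := (Finset.mem_insert.1 hu).resolve_left hune
  have hpu := hcons p (Finset.mem_insert_of_mem hp)
  rcases Finset.mem_insert.1 hv with rfl | hve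
  · refine ⟨p, hp, u, hue, (c v)⁻¹ * h⁻¹ * c v, ?_⟩
    simp only [Fin.lt_def] at huv hpk hpu
    funext l
    simp only [intervalTuple, Pi.mul_apply, Fin.lt_def, Fin.le_def]
    split_ifs <;> first | omega | (simp [mul_assoc])
  · have hvk := hk v hve
    by_cases hle : p ≤ u
    · refine ⟨u, hue, v, hve, (c k)⁻¹ * h * c k, ?_⟩
      simp only [Fin.lt_def, Fin.le_def] at huv hpk hpu hvk hle
      funext l
      simp only [intervalTuple, Pi.mul_apply, Fin.lt_def, Fin.le_def]
      split_ifs <;> first | omega | (simp [mul_assoc])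
    · refine ⟨u, hue, v, hve, h, ?_⟩
      simp only [Fin.lt_def, Fin.le_def] at huv hpk hpu hvk hle
      funext l
      simp only [intervalTuple, Pi.mul_apply, Fin.lt_def, Fin.le_def]
      split_ifs <;> first | omega | simp

/-- The word moves `Φ^{p,k}`-sets so that they become `Φ^{p,k,m}`-measurable in the extension, while
it fixes every `Φ^e`-set with `p, m ∈ e`. -/
theorem interval_word_add_top {p k m : Fin d} (hpm : p < m) (hkm : k < m) (hkp : k ≠ p)
    {γ : Fin d → G} (hγ : γ ∈ PhiGen G (insert k {p, m})) (c : Fin d → G) :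
    ∃ a ∈ ({p, k} : Finset (Fin d)), ∃ b ∈ ({p, k} : Finset (Fin d)), ∃ g : G,
      intervalTuple p m ((γ * c) m)⁻¹ * γ = intervalTuple a b g * intervalTuple p m (c m)⁻¹ := by
  obtain ⟨u, hu, v, hv, huv, hcons, h, rfl⟩ := hγ
  have hk := hcons k (by simp)
  have hp := hcons p (by simp)
  simp only [Finset.mem_insert, Finset.mem_singleton] at hu hv
  simp only [ne_eq, Fin.ext_iff, Fin.lt_def] at hk hp hpm hkm hkp huv
  have finish : ∀ a ∈ ({p, k} : Finset (Fin d)), ∀ b ∈ ({p, k} : Finset (Fin d)), ∀ g : G,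
      (∀ l, intervalTuple p m ((intervalTuple u v h * c) m)⁻¹ l * intervalTuple u v h l =
        intervalTuple a b g l * intervalTuple p m (c m)⁻¹ l) →
      ∃ a ∈ ({p, k} : Finset (Fin d)), ∃ b ∈ ({p, k} : Finset (Fin d)), ∃ g : G,
      intervalTuple p m ((intervalTuple u v h * c) m)⁻¹ * intervalTuple u v h =
        intervalTuple a b g * intervalTuple p m (c m)⁻¹ :=
    fun a ha b hb g hl => ⟨a, ha, b, hb, g, funext hl⟩
  rcases hu with rfl | rfl | rfl <;> rcases hv with rfl | rfl | rfl <;> try omega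
  · refine finish u (by simp) v (by simp) h fun l => ?_
    simp only [intervalTuple, Pi.mul_apply, Fin.lt_def, Fin.le_def]
    split_ifs <;> first | omega | simp
  · refine finish p (by simp) u (by simp) ((c v)⁻¹ * h⁻¹ * c v) fun l => ?_
    simp only [intervalTuple, Pi.mul_apply, Fin.lt_def, Fin.le_def]
    split_ifs <;> first | omega | (simp [mul_assoc])
  · refine finish u (by simp) v (by simp) ((c m)⁻¹ * h * c m) fun l => ?_
    simp only [intervalTuple, Pi.mul_apply, Fin.lt_def, Fin.le_def]
    split_ifs <;> first | omega | (simp [mul_assoc])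
  · refine finish u (by simp) u (by simp) 1 fun l => ?_
    simp only [intervalTuple, Pi.mul_apply, Fin.lt_def, Fin.le_def]
    split_ifs <;> first | omega | (simp [mul_assoc])

/-- This inserts `r` between its neighbours `s` and `t`. The two intervals take exponents from
separate coordinates of `c`, namely `r` in the lower interval and `r' = r + 1` in the upper one, so
a generator supported on one side of `r` alters only the exponent on that side. -/
theorem interval_word_add_interior {a : Finset (Fin d)} {s r r' t k : Fin d} (hs : s ∈ a)
    (ht : t ∈ a) (hsr : s < r) (hrt : r < t) (hr' : (r' : ℕ) = r + 1)
    (hgap : ∀ i ∈ a, i ≤ s ∨ t ≤ i)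
    {γ : Fin d → G} (hγ : γ ∈ PhiGen G (insert k (insert r a))) (c : Fin d → G) :
    ∃ u ∈ insert k a, ∃ v ∈ insert k a, ∃ g : G,
      intervalTuple s r ((γ * c) r)⁻¹ * intervalTuple r t ((γ * c) r')⁻¹ * γ =
        intervalTuple u v g * (intervalTuple s r (c r)⁻¹ * intervalTuple r t (c r')⁻¹) := by
  obtain ⟨u, hu, v, hv, huv, hcons, h, rfl⟩ := hγ
  have cs := hcons s (by simp [hs])
  have ct := hcons t (by simp [ht])
  have cr := hcons r (by simp)
  have hs' : s ∈ insert k a := by simp [hs]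
  have ht' : t ∈ insert k a := by simp [ht]
  have hk' : k ∈ insert k a := by simp
  have finish : ∀ u' ∈ insert k a, ∀ v' ∈ insert k a, ∀ g : G,
      (∀ l, intervalTuple s r ((intervalTuple u v h * c) r)⁻¹ l *
          intervalTuple r t ((intervalTuple u v h * c) r')⁻¹ l * intervalTuple u v h l =
        intervalTuple u' v' g l * (intervalTuple s r (c r)⁻¹ l * intervalTuple r t (c r')⁻¹ l)) →
      ∃ u' ∈ insert k a, ∃ v' ∈ insert k a, ∃ g : G,
      intervalTuple s r ((intervalTuple u v h * c) r)⁻¹ *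
          intervalTuple r t ((intervalTuple u v h * c) r')⁻¹ * intervalTuple u v h =
        intervalTuple u' v' g * (intervalTuple s r (c r)⁻¹ * intervalTuple r t (c r')⁻¹) :=
    fun a ha b hb g hl => ⟨a, ha, b, hb, g, funext hl⟩
  have hu2 : u = k ∨ u = r ∨ (u ∈ a ∧ ((u : ℕ) ≤ s ∨ (t : ℕ) ≤ u)) := by
    rcases Finset.mem_insert.1 hu with hu | hu
    · exact Or.inl hu
    · rcases Finset.mem_insert.1 hu with hu | hu
      · exact Or.inr (Or.inl hu)
      · exact Or.inr (Or.inr ⟨hu, hgap u hu⟩)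
  have hv2 : v = k ∨ v = r ∨ (v ∈ a ∧ ((v : ℕ) ≤ s ∨ (t : ℕ) ≤ v)) := by
    rcases Finset.mem_insert.1 hv with hv | hv
    · exact Or.inl hv
    · rcases Finset.mem_insert.1 hv with hv | hv
      · exact Or.inr (Or.inl hv)
      · exact Or.inr (Or.inr ⟨hv, hgap v hv⟩)
  simp only [Fin.lt_def] at cs ct cr huv hsr hrt
  -- Outside the interval from `s` to `t`, `γ` commutes with the word and leaves its exponents
  -- alone. Inside, a consecutive pair other than `(s, r)` and `(r, t)` must have `k` as an
  -- endpoint, as `a` has no element strictly between `s` and `t`.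
  by_cases hout : (v : ℕ) ≤ s ∨ (t : ℕ) ≤ u
  · have hu' : u ∈ insert k a := by
      rcases hu2 with rfl | rfl | hu2
      · exact hk'
      · omega
      · simp [hu2.1]
    have hv' : v ∈ insert k a := by
      rcases hv2 with rfl | rfl | hv2
      · exact hk'
      · omega
      · simp [hv2.1]
    refine finish u hu' v hv' h fun l => ?_
    simp only [intervalTuple, Pi.mul_apply, Fin.lt_def, Fin.le_def]
    split_ifs <;> first | omega | simp
  by_cases hlow : (v : ℕ) ≤ r
  · by_cases hvr : (v : ℕ) = r
    · by_cases hus : (u : ℕ) = s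
      · refine finish s hs' s hs' 1 fun l => ?_
        simp only [intervalTuple, Pi.mul_apply, Fin.lt_def, Fin.le_def]
        split_ifs <;> first | omega | (simp [mul_assoc])
      · obtain rfl : u = k := by
          rcases hu2 with rfl | rfl | hu2
          · rfl
          · omega
          · omega
        refine finish s hs' u hk' ((c r)⁻¹ * h⁻¹ * c r) fun l => ?_
        simp only [intervalTuple, Pi.mul_apply, Fin.lt_def, Fin.le_def]
        split_ifs <;> first | omega | (simp [mul_assoc])
    · obtain rfl : v = k := by
        rcases hv2 with rfl | rfl | hv2
        · rfl
        · omega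
        · omega
      have hus : (u : ℕ) = s := by
        rcases hu2 with rfl | rfl | hu2 <;> omega
      refine finish s hs' v hk' ((c r)⁻¹ * h * c r) fun l => ?_
      simp only [intervalTuple, Pi.mul_apply, Fin.lt_def, Fin.le_def]
      split_ifs <;> first | omega | (simp [mul_assoc])
  · by_cases hur : (u : ℕ) = r
    · by_cases hvt : (v : ℕ) = t
      · refine finish s hs' s hs' 1 fun l => ?_
        simp only [intervalTuple, Pi.mul_apply, Fin.lt_def, Fin.le_def]
        split_ifs <;> first | omega | (simp [mul_assoc])
      · obtain rfl : v = k := by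
          rcases hv2 with rfl | rfl | hv2
          · rfl
          · omega
          · omega
        refine finish v hk' t ht' ((c r')⁻¹ * h⁻¹ * c r') fun l => ?_
        simp only [intervalTuple, Pi.mul_apply, Fin.lt_def, Fin.le_def]
        split_ifs <;> first | omega | (simp [mul_assoc])
    · obtain rfl : u = k := by
        rcases hu2 with rfl | rfl | hu2
        · rfl
        · omega
        · omega
      have hvt : (v : ℕ) = t := by
        rcases hv2 with rfl | rfl | hv2 <;> omega
      refine finish u hk' t ht' ((c r')⁻¹ * h * c r') fun l => ?_
      simp only [intervalTuple, Pi.mul_apply, Fin.lt_def, Fin.le_def]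
      split_ifs <;> first | omega | (simp [mul_assoc])

end Words

/-! ### Vanishing integrals obtained from satedness. -/

section Coupling

variable {G : Type v} [Group G] {d : ℕ} {F : ℕ → Finset G}
  {X : GSpace.{u} (Fin d → G)} {θ : Measure (Fin d → X.carrier)}

theorem IsLimitCoupling.tendsto_box (hθ : IsLimitCoupling X F θ) (s : Finset (Fin d))
    (A : Fin d → Set X.carrier) (hA : ∀ i, MeasurableSet (A i)) :
    Tendsto (fun n => finsetAverage (F n) fun g =>
      X.μ.real {x | ∀ i ∈ s, X.T (initialTuple i g) x ∈ A i}) (hyperfilter ℕ)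
      (nhds (θ.real (box s A))) := by
  classical
  have := hθ.isProbabilityMeasure
  have hA' : ∀ i, MeasurableSet (if i ∈ s then A i else Set.univ) := fun i => by
    split_ifs
    · exact hA i
    · exact .univ
  have hbox : box s A = Set.univ.pi fun i => if i ∈ s then A i else Set.univ := by
    ext x
    simp only [box, Set.mem_ofPred_eq, Set.mem_univ_pi]
    refine forall_congr' fun i => ?_
    by_cases hi : i ∈ s <;> simp [hi]
  have h1 := (ENNReal.tendsto_toReal (measure_ne_top θ _)).comp (hθ.tendsto _ hA')
  rw [hbox]
  refine (h1.mono_left Nat.hyperfilter_le_atTop).congr fun n => ?_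
  have h2 := averageMap_real X.μ (F n) (p := fun g x i => X.T (initialTuple i g) x)
    (fun g => measurable_pi_lambda _ fun i => X.measurable_T _) (measurableSet_box s hA)
  rw [Function.comp_apply, ← hbox]
  exact h2

theorem IsLimitCoupling.preimage_ae_eq (hθ : IsLimitCoupling X F θ) {e : Finset (Fin d)}
    {B : Set X.carrier} (hB : MeasurableSet[Phi e X] B) {i j : Fin d} (hi : i ∈ e) (hj : j ∈ e) :
    (fun x : Fin d → X.carrier => x i) ⁻¹' B =ᵐ[θ] (fun x : Fin d → X.carrier => x j) ⁻¹' B := by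
  have := hθ.isProbabilityMeasure
  wlog hij : i ≤ j generalizing i j
  · exact (this hj hi (not_le.1 hij).le).symm
  refine ae_eq_of_tendsto_box (E := F) (p := fun g x i => X.T (initialTuple i g) x)
    hθ.tendsto_box i j hB.1 hB.1 fun g => ?_
  change X.T (initialTuple i g) ⁻¹' B =ᵐ[X.μ] X.T (initialTuple j g) ⁻¹' B
  exact (preimage_word_ae_eq hB ⟨i, hi, j, hj, g, (intervalTuple_mul_initialTuple hij g).symm⟩).symm

theorem IsLimitCoupling.liftsCoincide (hθ : IsLimitCoupling X F θ) (e : Finset (Fin d)) :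
    LiftsCoincide θ e (Phi e X) := fun _ hi _ hj _ hB =>
  measure_symmDiff_eq_zero_iff.2 (hθ.preimage_ae_eq hB hi hj)

variable [Countable G]

/-- Substituting `T_{[1;k]}^g x` for the base point rewrites the conditions at `s j < k` as
conditions on `T_{(s j;k]}^{g⁻¹}` of that point. These are moved copies that become `Φ^(e j ∪
{k})`-measurable in the extension. -/
theorem IsLimitCoupling.setIntegral_eq_zero_of_orth_top (hF : IsLeftFolner F)
    (hX : IsFullySated X) (hθ : IsLimitCoupling X F θ) (k : Fin d) {J : Type} [Fintype J]
    (e : J → Finset (Fin d)) (s : J → Fin d) (hs : ∀ j, s j ∈ e j) (hk : ∀ j, ∀ i ∈ e j, i < k)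
    (B : J → Set X.carrier) (hB : ∀ j, MeasurableSet[Phi (e j) X] (B j))
    {f : X.carrier → ℝ} (hf : Measurable f) {C : ℝ} (hfC : ∀ x, |f x| ≤ C)
    (hO : Orth X.μ (PhiJoin (Set.range fun j => insert k (e j)) X) f) :
    ∫ x in ⋂ j, (fun x : Fin d → X.carrier => x (s j)) ⁻¹' B j, f (x k) ∂θ = 0 := by
  classical
  have := hθ.isProbabilityMeasure
  have hk' : ∀ j, k ∉ e j := fun j h => lt_irrefl k (hk j k h)
  have hsk : ∀ j, s j < k := fun j => hk j _ (hs j)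
  obtain ⟨κ, hκ, hlim, h0⟩ := exists_limit_measure_of_isSated hF X
    (hX (Set.range fun j => insert k (e j)) (by
      rintro _ ⟨j, rfl⟩
      rw [Finset.card_insert_of_notMem (hk' j)]
      have := Finset.card_pos.2 ⟨_, hs j⟩
      omega))
    (fun j => insert k (e j)) (fun j => ⟨j, rfl⟩) B (fun j => (hB j).1)
    (fun j c => intervalTuple (s j) k (c k)⁻¹)
    fun j γ hγ c => preimage_word_ae_eq (hB j) (interval_word_push (hs j) (hk j) hγ c)
  set S : Set (Fin d → X.carrier) := ⋂ j, (fun x : Fin d → X.carrier => x (s j)) ⁻¹' B j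
  have hκθ : κ = (θ.restrict S).map fun x => x k := by
    ext A hA
    rw [← measureReal_eq_measureReal_iff, map_measureReal_apply (measurable_pi_apply k) hA,
      measureReal_restrict_apply (measurable_pi_apply k hA)]
    -- Several `j` may share the same `s j`, so each side collects all conditions placed on that
    -- coordinate.
    let A' : Fin d → Set X.carrier := fun i =>
      (if i = k then A else Set.univ) ∩ ⋂ j, if s j = i then B j else Set.univ
    have hA' : ∀ i, MeasurableSet (A' i) := fun i => by
      refine MeasurableSet.inter ?_ (MeasurableSet.iInter fun j => ?_) <;> split_ifs <;>
        first | assumption | exact (hB _).1 | exact .univ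
    have hmem : ∀ x : Fin d → X.carrier,
        (∀ i ∈ Finset.univ, x i ∈ A' i) ↔ x k ∈ A ∧ ∀ j, x (s j) ∈ B j := by
      intro x
      simp only [A', Finset.mem_univ, true_imp_iff, Set.mem_inter_iff, Set.mem_iInter]
      constructor
      · exact fun h => ⟨by simpa using (h k).1, fun j => by simpa using (h (s j)).2 j⟩
      · rintro ⟨h1, h2⟩ i
        refine ⟨?_, fun j => ?_⟩
        · split_ifs with h
          · exact h ▸ h1
          · trivial
        · split_ifs with h
          · exact h ▸ h2 j
          · trivial
    have hbox : (fun x : Fin d → X.carrier => x k) ⁻¹' A ∩ S = box Finset.univ A' := by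
      ext x
      refine Iff.trans ?_ (hmem x).symm
      simp only [S, Set.mem_inter_iff, Set.mem_preimage, Set.mem_iInter]
    rw [hbox]
    refine tendsto_nhds_unique (hlim A hA) ((hθ.tendsto_box Finset.univ A' hA').congr' ?_)
    filter_upwards [hF.eventually_nonempty.filter_mono Nat.hyperfilter_le_atTop] with n hn
    rw [finsetAverage_power_apply hn k fun g =>
      X.μ.real (A ∩ ⋂ j, X.T (intervalTuple (s j) k g⁻¹) ⁻¹' B j)]
    congr 1
    ext g
    have hm : MeasurableSet (A ∩ ⋂ j, X.T (intervalTuple (s j) k g⁻¹) ⁻¹' B j) :=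
      hA.inter (MeasurableSet.iInter fun j => X.measurable_T _ (hB j).1)
    rw [← (X.measurePreserving (initialTuple k g)).measureReal_preimage hm.nullMeasurableSet]
    congr 1
    ext x
    refine (hmem fun i => X.T (initialTuple i g) x).trans ?_
    simp only [Set.mem_preimage, Set.mem_inter_iff, Set.mem_iInter, ← X.T_mul,
      intervalTuple_inv_mul_initialTuple (hsk _).le]
  have h1 := h0 f hf ⟨C, hfC⟩ hO
  rwa [hκθ, integral_map (measurable_pi_apply k).aemeasurable hf.aestronglyMeasurable] at h1

/-- The word fixes `Φ^e`-sets, so moving the test sets from `Φ^(e₁ k)` does not change their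
correlation with a `Φ^e`-measurable `f`; once moved, they are `Φ^(e₂ k)`-measurable in the
extension. -/
theorem orth_of_words (hF : IsLeftFolner F) (hX : IsFullySated X) {e : Finset (Fin d)}
    (c : Finset (Fin d)) (e₁ e₂ : Fin d → Finset (Fin d)) (hcard : ∀ k ∈ c, 2 ≤ (e₂ k).card)
    (w : (Fin d → G) → (Fin d → G))
    (hwe : ∀ A, MeasurableSet[Phi e X] A → ∀ a, X.T (w a) ⁻¹' A =ᵐ[X.μ] A)
    (hw : ∀ k ∈ c, ∀ γ ∈ PhiGen G (e₂ k), ∀ a,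
      ∃ u ∈ e₁ k, ∃ v ∈ e₁ k, ∃ g : G, w (γ * a) * γ = intervalTuple u v g * w a)
    {f : X.carrier → ℝ} (hf : Measurable[Phi e X] f) {C : ℝ} (hfC : ∀ x, |f x| ≤ C)
    (hO : Orth X.μ (⨆ k ∈ c, Phi (e₂ k) X) f) : Orth X.μ (⨆ k ∈ c, Phi (e₁ k) X) f := by
  have hf' : Measurable f := hf.mono (Phi_le e X) le_rfl
  refine orth_iSup c (fun k _ => Phi_le _ X)
    (Integrable.of_bound hf'.aestronglyMeasurable C (ae_of_all _ hfC)) fun B hB => ?_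
  have hBm : ∀ k ∈ c, MeasurableSet (B k) := fun k hk => (hB k hk).1
  obtain ⟨κ, hκ, hlim, h0⟩ := exists_limit_measure_of_isSated hF X (J := {k // k ∈ c})
    (hX (Set.range fun k : {k // k ∈ c} => e₂ k) (by
      rintro _ ⟨k, rfl⟩
      exact hcard k k.2))
    (fun k => e₂ k) (fun k => ⟨k, rfl⟩) (fun k => B k) (fun k => hBm k k.2)
    (fun _ => w) fun k γ hγ a => preimage_word_ae_eq (hB k k.2) (hw k k.2 γ hγ a)
  set S : Set X.carrier := ⋂ k ∈ c, B k
  have hS : S = ⋂ k : {k // k ∈ c}, B k := by ext x; simp [S]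
  have hSm : MeasurableSet S := Finset.measurableSet_biInter c hBm
  have hκA : ∀ A, MeasurableSet[Phi e X] A → κ.real A = X.μ.real (A ∩ S) := by
    intro A hA
    refine tendsto_nhds_unique (hlim A hA.1) (tendsto_const_nhds.congr' ?_)
    filter_upwards [hF.eventually_nonempty.filter_mono Nat.hyperfilter_le_atTop] with n hn
    refine (finsetAverage_const (power_nonempty hn) fun a _ => ?_).symm
    rw [← (X.measurePreserving (w a)).measureReal_preimage
      ((hA.1.inter hSm).nullMeasurableSet), hS, Set.preimage_inter, Set.preimage_iInter]
    exact measureReal_congr ((hwe A hA a).symm.inter (ae_eq_refl _))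
  -- Only the restriction of `κ` to `Φ^e` matters for integrating `f`, and there it agrees with `μ`
  -- restricted to `S`.
  have htrim : κ.trim (Phi_le e X) = (X.μ.restrict S).trim (Phi_le e X) := by
    refine @Measure.ext _ (Phi e X) _ _ fun A hA => ?_
    rw [trim_measurableSet_eq _ hA, trim_measurableSet_eq _ hA, ← measureReal_eq_measureReal_iff,
      measureReal_restrict_apply hA.1, hκA A hA]
  have h1 := h0 f hf' ⟨C, hfC⟩ (by
    refine hO.mono ?_
    refine iSup₂_le fun i hi => ?_
    obtain ⟨k, rfl⟩ := hi
    exact le_iSup₂_of_le (f := fun k _ => Phi (e₂ k) X) k.1 k.2 le_rfl)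
  rw [integral_trim (Phi_le e X) (Measurable.stronglyMeasurable hf), htrim,
    ← integral_trim (Phi_le e X) (Measurable.stronglyMeasurable hf)] at h1
  exact h1

/-- The elements of `e` other than `p` are dropped one at a time: the interior ones by
`interval_word_add_interior`, then `m` by `interval_word_add_top`. Each word is built from intervals
with endpoints in `e`, hence fixes `Φ^e`-sets. -/
theorem orth_pairs_of_orth_insert (hF : IsLeftFolner F) (hX : IsFullySated X)
    {e : Finset (Fin d)} {p m : Fin d} (hp : p ∈ e) (hm : m ∈ e) (hpm : p < m)
    (hmin : ∀ i ∈ e, p ≤ i) (hmax : ∀ i ∈ e, i ≤ m) (c : Finset (Fin d)) (hce : ∀ k ∈ c, k ∉ e)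
    (hcm : ∀ k ∈ c, k < m) {f : X.carrier → ℝ} (hf : Measurable[Phi e X] f) {C : ℝ}
    (hfC : ∀ x, |f x| ≤ C) (hO : Orth X.μ (⨆ k ∈ c, Phi (insert k e) X) f) :
    Orth X.μ (⨆ k ∈ c, Phi (insert k {p}) X) f := by
  have hsub : ∀ n, ∀ a : Finset (Fin d), p ∈ a → m ∈ a → a ⊆ e → (e \ a).card = n →
      Orth X.μ (⨆ k ∈ c, Phi (insert k a) X) f := by
    intro n
    induction n with
    | zero =>
      intro a _ _ hae hcard
      rw [Finset.card_eq_zero, Finset.sdiff_eq_empty_iff_subset] at hcard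
      rwa [hae.antisymm hcard]
    | succ n ih =>
      intro a hpa hma hae hcard
      obtain ⟨r, hr⟩ : (e \ a).Nonempty := by
        rw [← Finset.card_pos]; omega
      obtain ⟨hre, hra⟩ := Finset.mem_sdiff.1 hr
      have hpr : p < r := lt_of_le_of_ne (hmin r hre) fun h => hra (h ▸ hpa)
      have hrm : r < m := lt_of_le_of_ne (hmax r hre) fun h => hra (h ▸ hma)
      have hne1 : (a.filter (· < r)).Nonempty := ⟨p, by simp [hpa, hpr]⟩
      have hne2 : (a.filter (r < ·)).Nonempty := ⟨m, by simp [hma, hrm]⟩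
      obtain ⟨s, hs, hsmax⟩ := Finset.exists_max_image _ id hne1
      obtain ⟨t, ht, htmin⟩ := Finset.exists_min_image _ id hne2
      simp only [Finset.mem_filter, id] at hs hsmax ht htmin
      have h1 := ih (insert r a) (by simp [hpa]) (by simp [hma])
        (Finset.insert_subset hre hae) (by
          have h2 := Finset.card_sdiff_of_subset (Finset.insert_subset hre hae)
          rw [Finset.card_sdiff_of_subset hae] at hcard
          rw [h2, Finset.card_insert_of_notMem hra]
          omega)
      have hgap : ∀ i ∈ a, i ≤ s ∨ t ≤ i := fun i hi => by
        rcases lt_trichotomy i r with h | rfl | h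
        · exact Or.inl (hsmax i ⟨hi, h⟩)
        · exact absurd hi hra
        · exact Or.inr (htmin i ⟨hi, h⟩)
      refine orth_of_words hF hX c _ _ (fun k hk => ?_)
        (fun a => intervalTuple s r (a r)⁻¹ * intervalTuple r t (a ⟨r + 1, by
          have := hrm; simp only [Fin.lt_def] at this; omega⟩)⁻¹) (fun A hA b => ?_)
        (fun k hk γ hγ b => interval_word_add_interior hs.1 ht.1 hs.2 ht.2 rfl hgap hγ b) hf hfC h1
      · rw [Finset.card_insert_of_notMem fun h => hce k hk (Finset.insert_subset hre hae h)]
        have := Finset.card_pos.2 ⟨r, Finset.mem_insert_self r a⟩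
        omega
      · rw [X.preimage_mul]
        exact ((X.measurePreserving _).quasiMeasurePreserving.preimage_ae_eq
          (preimage_intervalTuple_ae_eq hA (hae hs.1) hre _)).trans
          (preimage_intervalTuple_ae_eq hA hre (hae ht.1) _)
  have h1 := hsub _ {p, m} (by simp) (by simp)
    (Finset.insert_subset hp (Finset.singleton_subset_iff.2 hm)) rfl
  refine orth_of_words hF hX c _ (fun k => insert k {p, m}) (fun k hk => ?_)
    (fun a => intervalTuple p m (a m)⁻¹)
    (fun A hA b => preimage_intervalTuple_ae_eq hA hp hm _) (fun k hk γ hγ b => ?_) hf hfC h1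
  · have hkpm : k ∉ ({p, m} : Finset (Fin d)) := fun h => hce k hk
      (Finset.insert_subset hp (Finset.singleton_subset_iff.2 hm) h)
    rw [Finset.card_insert_of_notMem hkpm]
    have := Finset.card_pos.2 ⟨p, Finset.mem_insert_self p {m}⟩
    omega
  · have h2 := interval_word_add_top hpm (hcm k hk) (fun h => hce k hk (h ▸ hp)) hγ b
    rwa [Finset.pair_comm] at h2

end Coupling

/-! ### Orthogonality to coordinates under the limit coupling. -/

section Coupling

variable {G : Type v} [Group G] {d : ℕ} {F : ℕ → Finset G}
  {X : GSpace.{u} (Fin d → G)} {θ : Measure (Fin d → X.carrier)}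

/-- The `σ`-algebra of the coordinates `k ∈ c`. -/
@[reducible] def coordJoin (X : GSpace.{u} (Fin d → G)) (c : Finset (Fin d)) :
    MeasurableSpace (Fin d → X.carrier) :=
  ⨆ k ∈ c, X.measurableSpace.comap fun x : Fin d → X.carrier => x k

theorem integrable_comp_eval [IsProbabilityMeasure θ] {f : X.carrier → ℝ} (hf : Measurable f)
    {C : ℝ} (hfC : ∀ x, |f x| ≤ C) (i : Fin d) :
    Integrable (fun x : Fin d → X.carrier => f (x i)) θ :=
  Integrable.of_bound (hf.comp (measurable_pi_apply i)).aestronglyMeasurable C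
    (ae_of_all _ fun _ => hfC _)

theorem iSup_Phi_le (c : Finset (Fin d)) (e : Fin d → Finset (Fin d)) :
    ⨆ k ∈ c, Phi (e k) X ≤ X.measurableSpace := iSup₂_le fun _ _ => Phi_le _ X

variable [Countable G]

/-- The test function at `k` may be replaced by its projection to the join of `Φ^(e ∪ {k})` and the
`Φ^{j,k}`, `j ∈ s`. Those sets can be read at the coordinates `p` and `j` instead, so `x_k`
disappears and the case of `s` applies. -/
theorem IsLimitCoupling.orth_insert_top (hF : IsLeftFolner F) (hX : IsFullySated X)
    (hθ : IsLimitCoupling X F θ) {e : Finset (Fin d)} {p k : Fin d} (hp : p ∈ e)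
    (hk : ∀ i ∈ e, i < k) {s : Finset (Fin d)} (hs : ∀ i ∈ s, i < k)
    (ih : ∀ f : X.carrier → ℝ, Measurable[Phi e X] f → (∃ C, ∀ x, |f x| ≤ C) →
      Orth X.μ (⨆ j ∈ s, Phi (insert j e) X) f → Orth θ (coordJoin X s) fun x => f (x p))
    {f : X.carrier → ℝ} (hf : Measurable[Phi e X] f) {C : ℝ} (hfC : ∀ x, |f x| ≤ C)
    (hO : Orth X.μ (⨆ j ∈ insert k s, Phi (insert j e) X) f) :
    Orth θ (coordJoin X (insert k s)) fun x => f (x p) := by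
  classical
  have := hθ.isProbabilityMeasure
  have hf' : Measurable f := hf.mono (Phi_le e X) le_rfl
  let π : Fin d → (Fin d → X.carrier) → X.carrier := fun i x => x i
  have hπ : ∀ i, Measurable (π i) := fun i => measurable_pi_apply i
  refine orth_iSup _ (fun j _ => (measurable_pi_apply j).comap_le)
    (integrable_comp_eval hf' hfC p) fun B hB => ?_
  have hB' : ∀ j, ∃ A, MeasurableSet A ∧ (j ∈ insert k s → B j = π j ⁻¹' A) := by
    intro j
    by_cases hj : j ∈ insert k s
    · obtain ⟨A, hA, hAB⟩ := hB j hj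
      exact ⟨A, hA, fun _ => hAB.symm⟩
    · exact ⟨∅, .empty, fun h => absurd h hj⟩
  choose A hA hAB using hB'
  set S : Set (Fin d → X.carrier) := ⋂ j ∈ s, π j ⁻¹' A j
  have hSm : MeasurableSet S := Finset.measurableSet_biInter s fun j _ => hπ j (hA j)
  have hBS : ⋂ j ∈ insert k s, B j = π k ⁻¹' A k ∩ S := by
    rw [Finset.set_biInter_insert, hAB k (Finset.mem_insert_self k s)]
    congr 1
    exact Set.iInter₂_congr fun j hj => hAB j (Finset.mem_insert_of_mem hj)
  rw [hBS]
  let ins : Option {j // j ∈ s} → Finset (Fin d) := fun o => o.elim e fun j => {j.1}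
  let src : Option {j // j ∈ s} → Fin d := fun o => o.elim p fun j => j.1
  have hsrc : ∀ o, src o ∈ ins o := by rintro (_ | j) <;> simp [src, ins, hp]
  have hins : ∀ o, ∀ i ∈ ins o, i < k := by
    rintro (_ | j) i hi
    · exact hk i hi
    · simp only [ins, Option.elim, Finset.mem_singleton] at hi
      exact hi ▸ hs j j.2
  let I : Set (Finset (Fin d)) := Set.range fun o => insert k (ins o)
  have hI : PhiJoin I X ≤ X.measurableSpace := iSup₂_le fun _ _ => Phi_le _ X
  let a : X.carrier → ℝ := (A k).indicator fun _ => 1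
  have ham : Measurable a := measurable_const.indicator (hA k)
  have haC : ∀ x, |a x| ≤ 1 := fun x => by
    by_cases hx : x ∈ A k <;> simp [a, hx]
  obtain ⟨q, hqm, hqC, -, hqO⟩ := exists_bounded_projection (μ := X.μ) hI ham haC
  have hqm' : Measurable q := hqm.mono hI le_rfl
  have haq : ∀ x, |a x - q x| ≤ 1 + |1| := fun x => (abs_sub _ _).trans (add_le_add (haC x) (hqC x))
  -- The part of the indicator of `A k` that is orthogonal to `Φ^I` does not contribute.
  have h1 : Orth θ ((Phi e X).comap (π p)) (S.indicator fun x => a (x k) - q (x k)) := by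
    rintro _ ⟨E, hE, rfl⟩
    have h2 := hθ.setIntegral_eq_zero_of_orth_top hF hX k ins src hsrc hins
      (fun o => o.elim E fun j => A j.1) (by
        rintro (_ | j)
        · exact hE
        · refine ⟨hA j, ?_⟩
          rintro _ ⟨u, hu, v, hv, huv, -⟩
          simp only [ins, Option.elim, Finset.mem_singleton] at hu hv
          exact absurd (hu.trans hv.symm) huv.ne)
      (ham.sub hqm') haq hqO
    rw [setIntegral_indicator hSm, ← h2]
    congr 2
    ext x
    simp [S, π, src, Option.forall]
  have hai := (integrable_comp_eval (θ := θ) (ham.sub hqm') haq k)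
  have hfp : Measurable[(Phi e X).comap (π p)] fun x : Fin d → X.carrier => f (x p) := by
    intro t ht
    exact ⟨f ⁻¹' t, hf ht, rfl⟩
  have h3 := h1.integral_mul (((hπ p).comap_le).trans' (MeasurableSpace.comap_mono (Phi_le e X)))
    (hai.indicator hSm) (g := fun x => f (x p)) hfp
    (C := C) fun x => hfC _
  -- Sets in `Φ^{j,k}` are absorbed into `A j`. A set in `Φ^(e ∪ {k})` multiplies `f`, which keeps
  -- the needed orthogonality because `k` belongs to the family in `hO`.
  have h4 : Orth θ ((PhiJoin I X).comap (π k)) (S.indicator fun x => f (x p)) := by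
    have hIeq : (PhiJoin I X).comap (π k) =
        ⨆ o ∈ (Finset.univ : Finset (Option {j // j ∈ s})),
          (Phi (insert k (ins o)) X).comap (π k) := by
      simp only [PhiJoin, I, iSup_range, MeasurableSpace.comap_iSup, Finset.mem_univ, iSup_pos]
    rw [hIeq]
    refine orth_iSup _
      (fun o _ => ((hπ k).comap_le).trans' (MeasurableSpace.comap_mono (Phi_le _ X)))
      ((integrable_comp_eval hf' hfC p).indicator hSm) fun D hD => ?_
    choose E hE hED using fun o => hD o (Finset.mem_univ o)
    have hEm : ∀ o, MeasurableSet (E o) := fun o => (hE o).1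
    have hDE : (⋂ o ∈ (Finset.univ : Finset (Option {j // j ∈ s})), D o) =ᵐ[θ]
        ⋂ o, π (src o) ⁻¹' E o := by
      simp only [Finset.mem_univ, Set.iInter_true]
      refine Filter.EventuallyEq.countable_iInter fun o => ?_
      rw [← hED o]
      exact hθ.preimage_ae_eq (hE o) (Finset.mem_insert_self _ _)
        (Finset.mem_insert_of_mem (hsrc o))
    rw [setIntegral_congr_set hDE, setIntegral_indicator hSm]
    have h5 := ih ((E none).indicator f)
      (hf.indicator (Phi_mono (Finset.subset_insert k e) X _ (hE none)))
      ⟨C, fun x => by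
        by_cases hx : x ∈ E none
        · simpa [hx] using hfC x
        · simpa [hx] using (abs_nonneg _).trans (hfC x)⟩
      ((hO.indicator (iSup_Phi_le _ _)
        ((le_iSup₂_of_le (f := fun j _ => Phi (insert j e) X) k (Finset.mem_insert_self k s)
          le_rfl) _ (hE none))).mono (iSup₂_le fun j hj =>
            le_iSup₂_of_le (f := fun j _ => Phi (insert j e) X) j (Finset.mem_insert_of_mem hj)
              le_rfl))
      (⋂ j : {j // j ∈ s}, π j ⁻¹' (A j ∩ E (some j)))
      (MeasurableSet.iInter fun j => (le_iSup₂_of_le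
        (f := fun k _ => X.measurableSpace.comap fun x : Fin d → X.carrier => x k) j.1 j.2 le_rfl)
          _ ⟨_, (hA j).inter (hEm _), rfl⟩)
    have h6 : (fun x : Fin d → X.carrier => (E none).indicator f (x p)) =
        (π p ⁻¹' E none).indicator fun x => f (x p) := by
      ext x; simp [Set.indicator, π]
    rw [h6, setIntegral_indicator (hπ p (hEm none))] at h5
    rw [← h5]
    congr 2
    ext x
    simp only [S, π, Set.mem_inter_iff, Set.mem_iInter, Set.mem_preimage, Option.forall,
      Subtype.forall, src, Option.elim]
    constructor
    · rintro ⟨⟨h7, h8⟩, h9⟩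
      exact ⟨fun j hj => ⟨h9 j hj, h8 j hj⟩, h7⟩
    · rintro ⟨h7, h8⟩
      exact ⟨⟨h8, fun j hj => (h7 j hj).2⟩, fun j hj => (h7 j hj).1⟩
  have hqk : Measurable[(PhiJoin I X).comap (π k)] fun x : Fin d → X.carrier => q (x k) := by
    intro t ht
    exact ⟨q ⁻¹' t, hqm ht, rfl⟩
  have h7 := h4.integral_mul (((hπ k).comap_le).trans' (MeasurableSpace.comap_mono hI))
    ((integrable_comp_eval hf' hfC p).indicator hSm) (g := fun x => q (x k))
    hqk (C := |1|) fun x => hqC _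
  rw [← integral_indicator ((hπ k (hA k)).inter hSm)]
  have hi1 : Integrable (fun x => S.indicator (fun x : Fin d → X.carrier => a (x k) - q (x k)) x *
      f (x p)) θ :=
    (hai.indicator hSm).mul_bdd (c := C) (hf'.comp (hπ p)).aestronglyMeasurable
      (ae_of_all _ fun x => hfC _)
  have hi2 : Integrable (fun x => S.indicator (fun x : Fin d → X.carrier => f (x p)) x *
      q (x k)) θ :=
    ((integrable_comp_eval hf' hfC p).indicator hSm).mul_bdd (c := |1|)
      (hqm'.comp (hπ k)).aestronglyMeasurable (ae_of_all _ fun x => hqC _)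
  have h8 := integral_add hi1 hi2
  rw [h3, h7, add_zero] at h8
  rw [← h8]
  congr 1
  ext x
  by_cases hxS : x ∈ S <;> by_cases hxA : x k ∈ A k <;>
    simp [Set.indicator, hxS, hxA, π, a] <;> ring

theorem IsLimitCoupling.orth_singleton (hF : IsLeftFolner F) (hX : IsFullySated X)
    (hθ : IsLimitCoupling X F θ) {p : Fin d} {c : Finset (Fin d)} (hpc : p ∉ c)
    {f : X.carrier → ℝ} (hf : Measurable f) {C : ℝ} (hfC : ∀ x, |f x| ≤ C)
    (hO : Orth X.μ (⨆ k ∈ c, Phi (insert k {p}) X) f) :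
    Orth θ (coordJoin X c) fun x => f (x p) := by
  classical
  have := hθ.isProbabilityMeasure
  -- A singleton has no two consecutive elements, so `Φ^{i}` is the whole σ-algebra and `e = {p}` is
  -- an instance of the general scheme.
  have hsing : ∀ i, X.measurableSpace ≤ Phi {i} X := by
    intro i B hB
    refine ⟨hB, ?_⟩
    rintro _ ⟨u, hu, v, hv, huv, -⟩
    simp only [Finset.mem_singleton] at hu hv
    exact absurd (hu.trans hv.symm) huv.ne
  suffices h : ∀ c : Finset (Fin d), p ∉ c → ∀ f : X.carrier → ℝ, Measurable[Phi {p} X] f →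
      (∃ C, ∀ x, |f x| ≤ C) → Orth X.μ (⨆ k ∈ c, Phi (insert k {p}) X) f →
      Orth θ (coordJoin X c) fun x => f (x p) from
    h c hpc f (hf.mono (hsing p) le_rfl) ⟨C, hfC⟩ hO
  clear hO hfC hf f hpc c
  have hbase : ∀ c : Finset (Fin d), (∀ k ∈ c, k < p) → ∀ f : X.carrier → ℝ,
      Measurable[Phi {p} X] f → (∃ C, ∀ x, |f x| ≤ C) →
      Orth X.μ (⨆ k ∈ c, Phi (insert k {p}) X) f → Orth θ (coordJoin X c) fun x => f (x p) := by
    rintro c hc f hf ⟨C, hfC⟩ hO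
    have hf' : Measurable f := hf.mono (Phi_le _ X) le_rfl
    refine orth_iSup _ (fun j _ => (measurable_pi_apply j).comap_le)
      (integrable_comp_eval hf' hfC p) fun B hB => ?_
    choose A hA hAB using hB
    have h1 := hθ.setIntegral_eq_zero_of_orth_top hF hX p (J := {k // k ∈ c}) (fun k => {k.1})
      (fun k => k.1) (by simp) (fun k i hi => by
        rw [Finset.mem_singleton] at hi; exact hi ▸ hc k k.2)
      (fun k => A k.1 k.2) (fun k => hsing _ _ (hA k.1 k.2)) hf' hfC (hO.mono (by
        refine iSup₂_le fun i hi => ?_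
        obtain ⟨k, rfl⟩ := hi
        simp only [Finset.pair_comm p]
        exact le_iSup₂_of_le (f := fun k _ => Phi (insert k {p}) X) k.1 k.2 le_rfl))
    rw [← h1]
    congr 2
    ext x
    simp only [Set.mem_iInter, Subtype.forall]
    exact forall₂_congr fun k hk => by rw [← hAB k hk]
  intro c
  induction c using Finset.induction_on_max with
  | empty => exact fun _ => hbase ∅ (by simp)
  | insert k s hks ih =>
    intro hp f hf hfC hO
    rcases lt_trichotomy k p with h | rfl | h
    · refine hbase _ (fun i hi => ?_) f hf hfC hO
      rcases Finset.mem_insert.1 hi with rfl | hi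
      · exact h
      · exact (hks i hi).trans h
    · simp at hp
    · obtain ⟨C, hfC⟩ := hfC
      exact hθ.orth_insert_top hF hX (Finset.mem_singleton_self p)
        (fun i hi => by rw [Finset.mem_singleton] at hi; exact hi ▸ h) hks
        (ih fun h' => hp (Finset.mem_insert_of_mem h')) hf hfC hO

/-- The main orthogonality relation: a `Φ^e`-measurable function of one coordinate in `e` which is
orthogonal to all `Φ^(e ∪ {k})`, `k ∈ c`, is orthogonal to the coordinates in `c`. -/
theorem IsLimitCoupling.orth_coordJoin (hF : IsLeftFolner F) (hX : IsFullySated X)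
    (hθ : IsLimitCoupling X F θ) {e : Finset (Fin d)} {p : Fin d} (hp : p ∈ e)
    (hmin : ∀ i ∈ e, p ≤ i) {c : Finset (Fin d)} (hce : ∀ k ∈ c, k ∉ e)
    {f : X.carrier → ℝ} (hf : Measurable[Phi e X] f) {C : ℝ} (hfC : ∀ x, |f x| ≤ C)
    (hO : Orth X.μ (⨆ k ∈ c, Phi (insert k e) X) f) :
    Orth θ (coordJoin X c) fun x => f (x p) := by
  classical
  have := hθ.isProbabilityMeasure
  obtain ⟨m, hm, hmax⟩ := Finset.exists_max_image e id ⟨p, hp⟩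
  simp only [id] at hmax
  rcases (hmin m hm).eq_or_lt with rfl | hpm
  · have he : e = {p} := by
      ext i
      rw [Finset.mem_singleton]
      exact ⟨fun hi => le_antisymm (hmax i hi) (hmin i hi), fun h => h ▸ hp⟩
    subst he
    exact hθ.orth_singleton hF hX (fun h => hce p h hp) (hf.mono (Phi_le _ X) le_rfl) hfC hO
  -- Below `max e` the top coordinate of `e` is in the way; `orth_pairs_of_orth_insert` trades `e`
  -- for its least element.
  have hbase : ∀ c : Finset (Fin d), (∀ k ∈ c, k ∉ e) → (∀ k ∈ c, k < m) →
      ∀ f : X.carrier → ℝ, Measurable[Phi e X] f → (∃ C, ∀ x, |f x| ≤ C) →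
      Orth X.μ (⨆ k ∈ c, Phi (insert k e) X) f → Orth θ (coordJoin X c) fun x => f (x p) := by
    rintro c hce hcm f hf ⟨C, hfC⟩ hO
    exact hθ.orth_singleton hF hX (fun h => hce p h hp) (hf.mono (Phi_le _ X) le_rfl) hfC
      (orth_pairs_of_orth_insert hF hX hp hm hpm hmin hmax c hce hcm hf hfC hO)
  suffices h : ∀ c : Finset (Fin d), (∀ k ∈ c, k ∉ e) → ∀ f : X.carrier → ℝ,
      Measurable[Phi e X] f → (∃ C, ∀ x, |f x| ≤ C) →
      Orth X.μ (⨆ k ∈ c, Phi (insert k e) X) f → Orth θ (coordJoin X c) fun x => f (x p) from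
    h c hce f hf ⟨C, hfC⟩ hO
  intro c
  induction c using Finset.induction_on_max with
  | empty => exact fun h => hbase ∅ h (by simp)
  | insert k s hks ih =>
    intro hce f hf hfC hO
    rcases lt_trichotomy k m with h | rfl | h
    · refine hbase _ hce (fun i hi => ?_) f hf hfC hO
      rcases Finset.mem_insert.1 hi with rfl | hi
      · exact h
      · exact (hks i hi).trans h
    · exact absurd hm (hce k (Finset.mem_insert_self k s))
    · obtain ⟨C, hfC⟩ := hfC
      exact hθ.orth_insert_top hF hX hp (fun i hi => (hmax i hi).trans_lt h) hks
        (ih fun i hi => hce i (Finset.mem_insert_of_mem hi)) hf hfC hO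

end Coupling

/-! ### Relative independence of the coordinates. -/

theorem exists_abs_prod_le {ι Ω : Type*} (s : Finset ι) {f : ι → Ω → ℝ}
    (hf : ∀ i, ∃ C, ∀ x, |f i x| ≤ C) : ∃ C, ∀ x, |∏ i ∈ s, f i x| ≤ C := by
  choose C hC using hf
  refine ⟨∏ i ∈ s, C i, fun x => ?_⟩
  rw [Finset.abs_prod]
  exact Finset.prod_le_prod (fun _ _ => abs_nonneg _) fun i _ => hC i x

/-- The `f i` are replaced by their projections `q i` one at a time; each difference is orthogonal
to the product of the remaining factors. -/
theorem relIndepFamily_of_orth {Ω ι : Type*} [Fintype ι] [DecidableEq ι]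
    {m n : ι → MeasurableSpace Ω} {mΩ : MeasurableSpace Ω} {μ : Measure Ω} [IsProbabilityMeasure μ]
    (hnm : ∀ i, n i ≤ m i) (hm : ∀ i, m i ≤ mΩ)
    (h : ∀ i f, Measurable[m i] f → (∃ C, ∀ x, |f x| ≤ C) → Orth μ (n i) f →
      Orth μ (⨆ j ∈ Finset.univ.erase i, m j) f) : RelIndepFamily μ m n := by
  refine ⟨hnm, hm, fun f hf hfC => ?_⟩
  have hq : ∀ i, ∃ q : Ω → ℝ, Measurable[n i] q ∧ (∃ C, ∀ x, |q x| ≤ C) ∧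
      q =ᵐ[μ] μ[f i | n i] ∧ Orth μ (n i) fun x => f i x - q x := by
    intro i
    obtain ⟨C, hC⟩ := hfC i
    obtain ⟨q, h1, h2, h3, h4⟩ := exists_bounded_projection (μ := μ) ((hnm i).trans (hm i))
      ((hf i).mono (hm i) le_rfl) hC
    exact ⟨q, h1, ⟨_, h2⟩, h3, h4⟩
  choose q hqm hqC hqe hqO using hq
  let r : Finset ι → ι → Ω → ℝ := fun s i => if i ∈ s then q i else f i
  have hrm : ∀ s i, Measurable[m i] (r s i) := by
    intro s i
    by_cases hi : i ∈ s
    · simpa [r, hi] using (hqm i).mono (hnm i) le_rfl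
    · simpa [r, hi] using hf i
  have hrC : ∀ s i, ∃ C, ∀ x, |r s i x| ≤ C := by
    intro s i
    by_cases hi : i ∈ s
    · simpa [r, hi] using hqC i
    · simpa [r, hi] using hfC i
  have hint : ∀ s, Integrable (fun x => ∏ i, r s i x) μ := by
    intro s
    obtain ⟨C, hC⟩ := exists_abs_prod_le Finset.univ (hrC s)
    exact Integrable.of_bound (Finset.measurable_fun_prod _ fun i _ =>
      (hrm s i).mono (hm i) le_rfl).aestronglyMeasurable C (ae_of_all _ hC)
  have key : ∀ s, ∫ x, ∏ i, r s i x ∂μ = ∫ x, ∏ i, f i x ∂μ := by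
    intro s
    induction s using Finset.induction_on with
    | empty => simp [r]
    | insert a s ha ih =>
      rw [← ih, ← sub_eq_zero, ← neg_eq_zero, neg_sub, ← integral_sub (hint _) (hint _)]
      have h1 : ∀ x, ∏ i, r s i x - ∏ i, r (insert a s) i x =
          (f a x - q a x) * ∏ i ∈ Finset.univ.erase a, r s i x := by
        intro x
        rw [← Finset.mul_prod_erase _ _ (Finset.mem_univ a),
          ← Finset.mul_prod_erase _ (fun i => r (insert a s) i x) (Finset.mem_univ a), sub_mul]
        have h2 : ∏ i ∈ Finset.univ.erase a, r (insert a s) i x =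
            ∏ i ∈ Finset.univ.erase a, r s i x :=
          Finset.prod_congr rfl fun i hi => by simp [r, Finset.ne_of_mem_erase hi]
        rw [h2]
        simp [r, ha]
      simp only [h1]
      obtain ⟨C, hC⟩ := exists_abs_prod_le (Finset.univ.erase a) (hrC s)
      obtain ⟨C₁, hC₁⟩ := hfC a
      obtain ⟨C₂, hC₂⟩ := hqC a
      have hdm : Measurable[m a] fun x => f a x - q a x :=
        (hf a).sub ((hqm a).mono (hnm a) le_rfl)
      have hdC : ∀ x, |f a x - q a x| ≤ C₁ + C₂ := fun x =>
        (abs_sub _ _).trans (add_le_add (hC₁ x) (hC₂ x))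
      refine (h a _ hdm ⟨_, hdC⟩ (hqO a)).integral_mul (iSup₂_le fun i _ => hm i)
        (Integrable.of_bound (hdm.mono (hm a) le_rfl).aestronglyMeasurable _ (ae_of_all _ hdC))
        ?_ hC
      refine @Finset.measurable_fun_prod _ _ _ _ _ _ (_) _ _ fun i hi => (hrm s i).mono ?_ le_rfl
      exact le_iSup₂_of_le (f := fun j _ => m j) i hi le_rfl
  have h2 := key Finset.univ
  simp only [r, Finset.mem_univ, if_true] at h2
  rw [← h2]
  refine integral_congr_ae ?_
  filter_upwards [ae_all_iff.2 hqe] with x hx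
  exact Finset.prod_congr rfl fun i _ => hx i

theorem exists_bounded_measurable_comp {Ω Z : Type*} [mZ : MeasurableSpace Z] {π : Ω → Z}
    {f : Ω → ℝ} (hf : Measurable[mZ.comap π] f) {C : ℝ} (hfC : ∀ x, |f x| ≤ C) :
    ∃ φ : Z → ℝ, Measurable φ ∧ (∀ z, |φ z| ≤ |C|) ∧ f = fun x => φ (π x) := by
  obtain ⟨φ, hφ, rfl⟩ := hf.exists_eq_measurable_comp
  refine ⟨fun z => max (-|C|) (min |C| (φ z)),
    measurable_const.max (measurable_const.min hφ), fun z => ?_, ?_⟩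
  · rw [abs_le]
    exact ⟨le_max_left _ _, max_le (by linarith [abs_nonneg C]) (min_le_left _ _)⟩
  · ext x
    have hx := abs_le.1 ((hfC x).trans (le_abs_self C))
    simp only [Function.comp_apply] at hx ⊢
    rw [min_eq_right hx.2, max_eq_right hx.1]

section Coupling

variable {G : Type v} [Group G] {d : ℕ} {F : ℕ → Finset G}
  {X : GSpace.{u} (Fin d → G)} {θ : Measure (Fin d → X.carrier)}

/-- Pairs suffice: any `e` in the up-set contains some pair `{k, i}`, and `Φ^e` decreases in `e`. -/
theorem PhiJoin_upSetOf (i : Fin d) (X : GSpace.{u} (Fin d → G)) :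
    PhiJoin (upSetOf i) X = ⨆ k ∈ Finset.univ.erase i, Phi (insert k {i}) X := by
  refine le_antisymm (iSup₂_le fun e he => ?_) (iSup₂_le fun k hk => ?_)
  · obtain ⟨k, hk, hki⟩ := Finset.exists_mem_ne he.1 i
    refine le_iSup₂_of_le (f := fun k _ => Phi (insert k {i}) X) k
      (Finset.mem_erase.2 ⟨hki, Finset.mem_univ _⟩) (Phi_mono (fun j hj => ?_) X)
    rcases Finset.mem_insert.1 hj with rfl | hj
    · exact hk
    · exact Finset.mem_singleton.1 hj ▸ he.2
  · exact le_iSup₂_of_le (f := fun e _ => Phi e X) (insert k {i})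
      ⟨(Finset.card_pair (Finset.ne_of_mem_erase hk)).ge, by simp⟩ le_rfl

theorem IsLimitCoupling.relIndepFamily [Countable G] (hF : IsLeftFolner F) (hX : IsFullySated X)
    (hθ : IsLimitCoupling X F θ) :
    RelIndepFamily θ
      (fun i : Fin d => X.measurableSpace.comap (fun x : Fin d → X.carrier => x i))
      (fun i : Fin d => (PhiJoin (upSetOf i) X).comap (fun x : Fin d → X.carrier => x i)) := by
  have := hθ.isProbabilityMeasure
  have hle : ∀ i, PhiJoin (upSetOf i) X ≤ X.measurableSpace :=
    fun i => iSup₂_le fun _ _ => Phi_le _ X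
  refine relIndepFamily_of_orth (fun i => MeasurableSpace.comap_mono (hle i))
    (fun i => (measurable_pi_apply i).comap_le) ?_
  rintro i f hf ⟨C, hC⟩ hO
  obtain ⟨φ, hφ, hφC, rfl⟩ := exists_bounded_measurable_comp hf hC
  rw [orth_comap_iff (measurable_pi_apply i) (hle i) hφ, hθ.marginal i, PhiJoin_upSetOf] at hO
  exact hθ.orth_singleton hF hX (Finset.notMem_erase i _) hφ hφC hO

end Coupling

/-! ### Relative independence of the oblique copies. -/

section Coupling

variable {G : Type v} [Group G] {d : ℕ} {F : ℕ → Finset G}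
  {X : GSpace.{u} (Fin d → G)} {θ : Measure (Fin d → X.carrier)}

theorem relCompletion_mono {Ω : Type*} {m m' mΩ : MeasurableSpace Ω} {μ : Measure Ω} (h : m ≤ m') :
    relCompletion μ m ≤ relCompletion μ m' := by
  refine le_inf (fun S hS => ?_) inf_le_right
  obtain ⟨S', hS', hSS'⟩ := (MeasurableSpace.measurableSet_inf.1 hS).1
  exact ⟨S', h S' hS', hSS'⟩

theorem le_relCompletion {Ω : Type*} {m mΩ : MeasurableSpace Ω} {μ : Measure Ω} (h : m ≤ mΩ) :
    m ≤ relCompletion μ m := le_inf (fun S hS => ⟨S, hS, EventuallyEq.rfl⟩) h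

theorem obliqueJoin_le {Ω : Type*} {mΩ : MeasurableSpace Ω} (θ : Measure (Fin d → Ω))
    (Ψ : Finset (Fin d) → MeasurableSpace Ω) (I : Set (Finset (Fin d))) :
    obliqueJoin θ Ψ I ≤ MeasurableSpace.pi :=
  iSup₂_le fun _ _ => iSup₂_le fun _ _ => inf_le_right

theorem obliqueJoin_mono {Ω : Type*} {mΩ : MeasurableSpace Ω} (θ : Measure (Fin d → Ω))
    (Ψ : Finset (Fin d) → MeasurableSpace Ω) {I J : Set (Finset (Fin d))} (h : I ⊆ J) :
    obliqueJoin θ Ψ I ≤ obliqueJoin θ Ψ J :=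
  iSup₂_le fun e he => le_iSup₂_of_le (f := fun e _ => obliqueCopy θ e (Ψ e)) e (h he) le_rfl

theorem comap_le_obliqueJoin {I : Set (Finset (Fin d))} {e : Finset (Fin d)}
    (he : e ∈ I) {i : Fin d} (hi : i ∈ e) :
    (Phi e X).comap (fun x : Fin d → X.carrier => x i) ≤
      obliqueJoin θ (fun e => Phi e X) I :=
  le_iSup₂_of_le (f := fun e _ => obliqueCopy θ e (Phi e X)) e he
    (le_iSup₂_of_le (f := fun i _ => relCompletion θ ((Phi e X).comap fun x => x i)) i hi
      (le_relCompletion (((measurable_pi_apply i).comap_le).trans'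
        (MeasurableSpace.comap_mono (Phi_le e X)))))

/-- Each `a ∈ I` has an element outside `e`, and the oblique copy may be read at that coordinate. -/
theorem IsLimitCoupling.obliqueJoin_le_relCompletion (hθ : IsLimitCoupling X F θ)
    {I : Set (Finset (Fin d))} {e : Finset (Fin d)} (hI : ∀ a ∈ I, ¬ a ⊆ e) :
    obliqueJoin θ (fun e => Phi e X) I ≤ relCompletion θ (coordJoin X (Finset.univ \ e)) := by
  refine iSup₂_le fun a ha => ?_
  obtain ⟨k, hka, hke⟩ := Finset.not_subset.1 (hI a ha)
  rw [obliqueCopy_eq (hθ.liftsCoincide a) hka]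
  exact relCompletion_mono (le_iSup₂_of_le
    (f := fun k _ => X.measurableSpace.comap fun x : Fin d → X.carrier => x k) k (by simpa using hke)
    (MeasurableSpace.comap_mono (Phi_le a X)))

variable [Countable G]

/-- Remove a minimal `e` of `I \ J`. A `Φ^e`-set is replaced by its projection to the join of the
`Φ^(e ∪ {k})`, `k ∉ e`, whose lift lies in the join over the smaller up-set, where induction
applies; the remainder is orthogonal to everything else by `orth_coordJoin`. -/
theorem IsLimitCoupling.orth_obliqueJoin (hF : IsLeftFolner F) (hX : IsFullySated X)
    (hθ : IsLimitCoupling X F θ) {I J : Set (Finset (Fin d))} (hI : IsUpperSet I)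
    (hJ : IsUpperSet J) (hne : ∀ e ∈ I, e.Nonempty) {g : (Fin d → X.carrier) → ℝ}
    (hg : Measurable[obliqueJoin θ (fun e => Phi e X) J] g) {C : ℝ} (hgC : ∀ x, |g x| ≤ C)
    (hO : Orth θ (obliqueJoin θ (fun e => Phi e X) (I ∩ J)) g) :
    Orth θ (obliqueJoin θ (fun e => Phi e X) I) g := by
  classical
  have := hθ.isProbabilityMeasure
  induction I using WellFoundedLT.induction with
  | ind I ih =>
  rcases (I \ J).eq_empty_or_nonempty with h0 | h0
  · rwa [Set.inter_eq_left.2 (Set.sdiff_eq_empty.1 h0)] at hO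
  obtain ⟨e, he⟩ := (I \ J).toFinite.exists_minimal h0
  have heI : e ∈ I := he.prop.1
  have heJ : e ∉ J := he.prop.2
  -- Since `J` is an up-set missing `e`, no subset of `e` lies in `J`, so `e` is minimal in `I`
  -- itself.
  have hmin : ∀ a ∈ I, a ⊆ e → a = e := fun a ha hae =>
    le_antisymm hae (he.le_of_le ⟨ha, fun h => heJ (hJ hae h)⟩ hae)
  set I' := I \ {e}
  have hI' : IsUpperSet I' := by
    rintro a b hab ⟨ha, hae⟩
    refine ⟨hI hab ha, ?_⟩
    rintro rfl
    exact hae (hmin a ha hab)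
  have hlt : I' < I := ⟨Set.sdiff_subset, fun h => (h heI).2 rfl⟩
  have hIJ : I' ∩ J ⊆ I ∩ J := Set.inter_subset_inter_left J Set.sdiff_subset
  have hg' := ih I' hlt hI' (fun a ha => hne a ha.1) (hO.mono (obliqueJoin_mono θ _ hIJ))
  have hgm : Measurable g := hg.mono (obliqueJoin_le θ _ J) le_rfl
  have hgi : Integrable g θ := Integrable.of_bound hgm.aestronglyMeasurable C (ae_of_all _ hgC)
  let p := e.min' (hne e heI)
  have hp : p ∈ e := Finset.min'_mem _ _
  have hsup : obliqueJoin θ (fun e => Phi e X) I ≤ obliqueJoin θ (fun e => Phi e X) I' ⊔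
      relCompletion θ ((Phi e X).comap fun x => x p) := by
    refine iSup₂_le fun a ha => ?_
    by_cases hae : a = e
    · subst hae
      rw [obliqueCopy_eq (hθ.liftsCoincide a) hp]
      exact le_sup_right
    · exact le_sup_of_le_left
        (le_iSup₂_of_le (f := fun e _ => obliqueCopy θ e (Phi e X)) a ⟨ha, hae⟩ le_rfl)
  have hrel : relCompletion θ ((Phi e X).comap fun x : Fin d → X.carrier => x p) ≤
      MeasurableSpace.pi := inf_le_right
  refine (orth_sup (obliqueJoin_le θ _ I') hrel hgi fun S S' hS hS' => ?_).mono hsup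
  obtain ⟨_, ⟨A, hA, rfl⟩, hSA⟩ := (MeasurableSpace.measurableSet_inf.1 hS').1
  have hSm : MeasurableSet S := obliqueJoin_le θ _ I' S hS
  have hAm : MeasurableSet A := hA.1
  rw [setIntegral_congr_set ((ae_eq_refl S).inter hSA)]
  let a : X.carrier → ℝ := A.indicator fun _ => 1
  have ham : Measurable[Phi e X] a := measurable_const.indicator hA
  have haC : ∀ x, |a x| ≤ 1 := fun x => by
    by_cases hx : x ∈ A <;> simp [a, hx]
  have hle : ⨆ k ∈ Finset.univ \ e, Phi (insert k e) X ≤ Phi e X :=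
    iSup₂_le fun k _ => Phi_mono (Finset.subset_insert k e) X
  obtain ⟨q, hqm, hqC, -, hqO⟩ := exists_bounded_projection (μ := X.μ)
    (hle.trans (Phi_le e X)) (ham.mono (Phi_le e X) le_rfl) haC
  have haq : ∀ x, |a x - q x| ≤ 1 + |1| := fun x =>
    (abs_sub _ _).trans (add_le_add (haC x) (hqC x))
  have haqm : Measurable[Phi e X] fun x => a x - q x := ham.sub (hqm.mono hle le_rfl)
  -- All the other indices involved leave `e`, so both `g` and `S` live on the coordinates outside
  -- `e` up to null sets.
  have hK : ∀ b ∈ I' ∪ J, ¬ b ⊆ e := by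
    rintro b (⟨hb, hbe⟩ | hb) h
    · exact hbe (hmin b hb h)
    · exact heJ (hJ h hb)
  have h1 := ((hθ.orth_coordJoin hF hX hp (fun i hi => Finset.min'_le _ _ hi)
    (fun k hk => (Finset.mem_sdiff.1 hk).2) haqm haq hqO).relCompletion).mono
      (hθ.obliqueJoin_le_relCompletion hK)
  have hSg : ∀ x, |S.indicator g x| ≤ C := fun x => by
    by_cases hx : x ∈ S
    · simpa [hx] using hgC x
    · simpa [hx] using (abs_nonneg _).trans (hgC x)
  have hi1 := integrable_comp_eval (θ := θ) (haqm.mono (Phi_le e X) le_rfl) haq p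
  have h2 := h1.integral_mul (obliqueJoin_le θ _ _) hi1 (g := S.indicator g)
    ((hg.mono (obliqueJoin_mono θ _ Set.subset_union_right) le_rfl).indicator
      (obliqueJoin_mono θ _ Set.subset_union_left S hS)) hSg
  have hqI : Measurable[obliqueJoin θ (fun e => Phi e X) I']
      fun x : Fin d → X.carrier => q (x p) := by
    have h3 : (⨆ k ∈ Finset.univ \ e, Phi (insert k e) X).comap
        (fun x : Fin d → X.carrier => x p) ≤ obliqueJoin θ (fun e => Phi e X) I' := by
      simp only [MeasurableSpace.comap_iSup]
      refine iSup₂_le fun k hk => comap_le_obliqueJoin (e := insert k e)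
        (show insert k e ∈ I' from ⟨hI (Finset.subset_insert k e) heI, fun h =>
          (Finset.mem_sdiff.1 hk).2 (Finset.insert_eq_self.1 h)⟩) (Finset.mem_insert_of_mem hp)
    exact fun t ht => h3 _ ⟨q ⁻¹' t, hqm ht, rfl⟩
  have hSq : ∀ x : Fin d → X.carrier, |S.indicator (fun x => q (x p)) x| ≤ |1| := fun x => by
    by_cases hx : x ∈ S
    · simpa [hx] using hqC (x p)
    · simp [hx]
  have hqIS := hqI.indicator hS
  have h4 := hg'.integral_mul (obliqueJoin_le θ _ _) hgi hqIS hSq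
  rw [← integral_indicator (hSm.inter (measurable_pi_apply p hAm))]
  have hi2 : Integrable (fun x => (a (x p) - q (x p)) * S.indicator g x) θ :=
    hi1.mul_bdd (c := C) (hgm.indicator hSm).aestronglyMeasurable (ae_of_all _ hSg)
  have hi3 : Integrable (fun x => g x * S.indicator (fun x => q (x p)) x) θ :=
    hgi.mul_bdd (c := |1|) (hqIS.mono (obliqueJoin_le θ _ _) le_rfl).aestronglyMeasurable
      (ae_of_all _ hSq)
  have h5 := integral_add hi2 hi3
  rw [h2, h4, add_zero] at h5
  rw [← h5]
  congr 1
  ext x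
  by_cases hxS : x ∈ S <;> by_cases hxA : x p ∈ A <;>
    simp [Set.indicator, hxS, hxA, a] <;> ring

theorem relIndep_of_orth {Ω : Type*} {m₁ m₂ m mΩ : MeasurableSpace Ω} {μ : Measure Ω}
    [IsProbabilityMeasure μ] (hm₁ : m ≤ m₁) (hm₂ : m ≤ m₂) (h₁ : m₁ ≤ mΩ) (h₂ : m₂ ≤ mΩ)
    (h : ∀ g, Measurable[m₂] g → (∃ C, ∀ x, |g x| ≤ C) → Orth μ m g → Orth μ m₁ g) :
    RelIndep μ m₁ m₂ m := by
  refine ⟨hm₁, hm₂, h₁, h₂, ?_⟩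
  rintro f g hf hg ⟨C, hC⟩ ⟨D, hD⟩
  have hf' := hf.mono h₁ le_rfl
  have hg' := hg.mono h₂ le_rfl
  have hm := hm₁.trans h₁
  obtain ⟨r, hr, hrC, hre, hrO⟩ := exists_bounded_projection (μ := μ) hm hf' hC
  obtain ⟨q, hq, hqC, hqe, hqO⟩ := exists_bounded_projection (μ := μ) hm hg' hD
  have hfi : Integrable f μ := .of_bound hf'.aestronglyMeasurable C (ae_of_all _ hC)
  have hgi : Integrable g μ := .of_bound hg'.aestronglyMeasurable D (ae_of_all _ hD)
  have hri : Integrable r μ :=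
    .of_bound (hr.mono hm le_rfl).aestronglyMeasurable _ (ae_of_all _ hrC)
  have hqi : Integrable q μ :=
    .of_bound (hq.mono hm le_rfl).aestronglyMeasurable _ (ae_of_all _ hqC)
  have h3 := (h _ (hg.sub (hq.mono hm₂ le_rfl))
    ⟨D + |D|, fun x => (abs_sub _ _).trans (add_le_add (hD x) (hqC x))⟩ hqO).integral_mul h₁
    (hgi.sub hqi) hf hC
  have h4 := hrO.integral_mul hm (hfi.sub hri) hq hqC
  have h5 : ∫ x, f x * g x ∂μ = ∫ x, r x * q x ∂μ := by
    have hi1 : Integrable (fun x => (g x - q x) * f x) μ :=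
      (hgi.sub hqi).mul_bdd (c := C) hf'.aestronglyMeasurable (ae_of_all _ hC)
    have hi2 : Integrable (fun x => (f x - r x) * q x) μ :=
      (hfi.sub hri).mul_bdd (c := |D|) (hq.mono hm le_rfl).aestronglyMeasurable
        (ae_of_all _ hqC)
    have hi3 : Integrable (fun x => r x * q x) μ :=
      hri.mul_bdd (c := |D|) (hq.mono hm le_rfl).aestronglyMeasurable (ae_of_all _ hqC)
    have h6 := integral_add (hi1.add hi2) hi3
    have h7 := integral_add hi1 hi2
    simp only [Pi.add_apply] at h6
    rw [h7] at h6
    change ∫ x, (g x - q x) * f x ∂μ = 0 at h3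
    rw [h3, h4, add_zero, zero_add] at h6
    rw [← h6]
    congr 1
    ext x
    ring
  rw [h5]
  refine integral_congr_ae ?_
  filter_upwards [hre, hqe] with x hx hx'
  rw [hx, hx']

end Coupling

theorem theorem5p3 {G : Type v} [Group G] [Countable G] {d : ℕ}
    (F : ℕ → Finset G) (hF : IsLeftFolner F)
    (X : GSpace.{u} (Fin d → G)) (hX : IsFullySated X)
    (θ : Measure (Fin d → X.carrier)) (hθ : IsLimitCoupling X F θ) :
    RelIndepFamily θ
        (fun i : Fin d => X.measurableSpace.comap (fun x : Fin d → X.carrier => x i))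
        (fun i : Fin d => (PhiJoin (upSetOf i) X).comap (fun x : Fin d → X.carrier => x i)) ∧
      RemovalHypotheses θ (fun e => Phi e X) := by
  have := hθ.isProbabilityMeasure
  refine ⟨hθ.relIndepFamily hF hX, fun e _ => Phi_le e X, fun a e _ h => Phi_mono h X,
    fun e _ => hθ.liftsCoincide e, fun I J hI _ hIu hJu => ?_⟩
  refine relIndep_of_orth (obliqueJoin_mono θ _ Set.inter_subset_left)
    (obliqueJoin_mono θ _ Set.inter_subset_right) (obliqueJoin_le θ _ I) (obliqueJoin_le θ _ J) ?_
  rintro g hg ⟨C, hC⟩ hO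
  exact hθ.orth_obliqueJoin hF hX hIu hJu
    (fun e he => Finset.card_pos.1 (by have := hI e he; omega)) hg hC hO
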